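/- Let $\eta(z)=e^{2\pi i z/24}\prod_{n\ge 1}(1-e^{2\pi i n z})$ be the Dedekind eta function on the upper half-plane, put $q=e^{2\pi i z}$, let $\sigma_7(n)=\sum_{d\mid n}d^7$, and define $\tau_{8,2}(n)$ and $\tau_{8,3}(n)$ by the Fourier expansions $$\Delta_{8,2}(z)=\eta^8(z)\eta^8(2z)=\sum_{n\ge 1}\tau_{8,2}(n)q^n,$$ $$\Delta_{8,3}(z)=\eta^{12}(z)\eta^4(3z)+18\,\eta^9(z)\eta^4(3z)\eta^3(9z)+81\,\eta^6(z)\eta^4(3z)\eta^6(9z)=\sum_{n\ge 1}\tau_{8,3}(n)q^n.$$ These expansions converge on the whole upper half-plane and their coefficients are integers. For every integer $\lambda\ge 1$ the following hold. (i) For every odd prime $p$, $\tau_{8,2}(p^\lambda)\equiv\sigma_7(p^\lambda)\pmod{17}$. (ii) For every prime $p\ge 5$, $\tau_{8,3}(p^\lambda)\equiv\sigma_7(p^\lambda)\pmod{41}$. (iii) In particular, $\tau_{8,2}(17^\lambda)\equiv 1\pmod{17}$ and $\tau_{8,3}(41^\lambda)\equiv 1\pmod{41}$. -/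

import Mathlib

open UpperHalfPlane ModularForm

noncomputable section

/-- The weight `8`, level `2` form `Δ_{8,2}(z) = η(z)^8 η(2z)^8` on the upper half-plane, where
`η` is Mathlib's Dedekind eta function `ModularForm.eta`. -/
def Delta82 (z : ℍ) : ℂ :=
  eta (z : ℂ) ^ 8 * eta (2 * (z : ℂ)) ^ 8

/-- The weight `8`, level `3` form
`Δ_{8,3}(z) = η(z)^12 η(3z)^4 + 18 η(z)^9 η(3z)^4 η(9z)^3 + 81 η(z)^6 η(3z)^4 η(9z)^6`. -/
def Delta83 (z : ℍ) : ℂ :=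
  eta (z : ℂ) ^ 12 * eta (3 * (z : ℂ)) ^ 4
    + 18 * (eta (z : ℂ) ^ 9 * eta (3 * (z : ℂ)) ^ 4 * eta (9 * (z : ℂ)) ^ 3)
    + 81 * (eta (z : ℂ) ^ 6 * eta (3 * (z : ℂ)) ^ 4 * eta (9 * (z : ℂ)) ^ 6)

/-- `τ_{8,2}(n)`, the `n`-th Fourier coefficient of `Δ_{8,2}` (in powers of `q = e^{2πiz}`). -/
def tau82 (n : ℕ) : ℂ := (UpperHalfPlane.qExpansion 1 Delta82).coeff n

/-- `τ_{8,3}(n)`, the `n`-th Fourier coefficient of `Δ_{8,3}` (in powers of `q = e^{2πiz}`). -/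
def tau83 (n : ℕ) : ℂ := (UpperHalfPlane.qExpansion 1 Delta83).coeff n

end

/-!
Write `E_k` for the normalised Eisenstein series of level one and put `(m, K) = (2, 136)` or
`(3, 123)`. The congruences are the reduction, modulo the prime divisor `17` of `136` and `41` of
`123`, of the exact identity

  `E₈(z) - E₈(mz) = 480 (Δ_{8,m}(z) + K ((E₄(z) - E₄(mz)) / 240) ^ 2)`

(`eisC_eight_sub_level_two`, `eisC_eight_sub_level_three`). Both `(E₈(z) - E₈(mz)) / 480` and
`(E₄(z) - E₄(mz)) / 240` have integral Fourier coefficients `σ_k(n) - σ_k(n / m)`, with `k = 7` and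
`k = 3`. So the identity expresses the coefficients of `Δ_{8,m}` as integers (`tauCoeff`), proves
that its Fourier expansion converges, and shows `τ_{8,m}(n) ≡ σ₇(n)` modulo each divisor of `K`
whenever `m ∤ n`.

The identity is proved by writing everything as a polynomial in two eta quotients: `φ(mz)` and
`ψ(mz)`, where `φ(z) = η(z/2)^8 / η(z)^4`, `ψ(z) = η(2z)^8 / η(z)^4` for `m = 2` (fourth powers of
Jacobi's theta functions) and `φ(z) = η(z/3)^3 / η(z)`, `ψ(z) = η(3z)^3 / η(z)` for `m = 3` (the
cubic theta functions of Borwein and Borwein). For `m = 2` the ingredients are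

* `φ(z + 1) = φ(z) + 16 ψ(z)` (Jacobi), so that `U = φ + 8 ψ` has period one;
* `η^12 = φ ψ (φ + 16 ψ)`;
* `U(z) = φ(2z) + 32 ψ(2z)`;
* `E₄ = φ^2 + 16 φ ψ + 256 ψ^2`;

and for `m = 3`, with `ζ = e^{2πi/3}`,

* `φ(z + 1) = φ(z) + 3 (1 - ζ) ψ(z)`, so that `U = φ + 3 ψ` has period one;
* `η^8 = φ ψ (φ^2 + 9 φ ψ + 27 ψ^2)`;
* `U(z) = φ(3z) + 9 ψ(3z)`;
* `E₄ = U (U^3 + 216 ψ^3)`.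

Each of these rests on one vanishing principle, `eq_zero_of_levelOne`: a holomorphic
function on the upper half-plane which transforms under `z ↦ z + 1` and `z ↦ -1/z` like a form of
level one and weight less than `12`, and which tends to `0` at `i∞`, is zero. Where the difference
of the two sides is not itself of level one, the principle is applied to the product of this
difference with its transforms under coset representatives, times a power of `η` if a character has
to be removed; one of the factors then vanishes identically, and these factors are carried to each
other by `z ↦ z + 1` and `z ↦ -1/z`. No Fourier coefficient has to be computed.
-/

section

open EisensteinSeries Filter MatrixGroups Topology

/-! ### The upper half-plane and the cusp `i∞` -/

theorem ne_zero_of_im_pos {z : ℂ} (hz : 0 < z.im) : z ≠ 0 := by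
  rintro rfl
  simp at hz

theorem neg_one_div_im_pos {z : ℂ} (hz : 0 < z.im) : 0 < (-1 / z).im := by
  have := UpperHalfPlane.im_inv_neg_coe_pos ⟨z, hz⟩
  rwa [neg_div, one_div, ← inv_neg]

theorem im_div_pos {z : ℂ} (hz : 0 < z.im) {n : ℕ} (hn : 0 < n) : 0 < (z / n).im := by
  rw [Complex.div_natCast_im]
  positivity

theorem im_mul_pos {z : ℂ} (hz : 0 < z.im) {n : ℕ} (hn : 0 < n) : 0 < (n * z).im := by
  rw [← nsmul_eq_mul, Complex.smul_im, nsmul_eq_mul]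
  positivity

theorem im_half_pos {z : ℂ} (hz : 0 < z.im) : 0 < (z / 2).im := im_div_pos hz two_pos

theorem im_two_mul_pos {z : ℂ} (hz : 0 < z.im) : 0 < (2 * z).im := im_mul_pos hz two_pos

theorem im_third_pos {z : ℂ} (hz : 0 < z.im) : 0 < (z / 3).im := im_div_pos hz three_pos

theorem im_three_mul_pos {z : ℂ} (hz : 0 < z.im) : 0 < (3 * z).im := im_mul_pos hz three_pos

theorem im_add_one_pos {z : ℂ} (hz : 0 < z.im) : 0 < (z + 1).im := by simpa using hz

theorem tendsto_affine_comap_im {r : ℝ} (hr : 0 < r) (b : ℝ) :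
    Tendsto (fun z : ℂ ↦ r * z + b) (comap Complex.im atTop) (comap Complex.im atTop) := by
  rw [tendsto_comap_iff]
  refine (tendsto_comap.const_mul_atTop hr).congr fun z ↦ ?_
  simp

theorem tendsto_mul_comap_im {n : ℕ} (hn : 0 < n) :
    Tendsto (fun z : ℂ ↦ n * z) (comap Complex.im atTop) (comap Complex.im atTop) := by
  simpa using tendsto_affine_comap_im (r := n) (by positivity) 0

theorem tendsto_div_comap_im {n : ℕ} (hn : 0 < n) :
    Tendsto (fun z : ℂ ↦ z / n) (comap Complex.im atTop) (comap Complex.im atTop) := by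
  simpa [div_eq_inv_mul] using tendsto_affine_comap_im (r := (n : ℝ)⁻¹) (by positivity) 0

theorem tendsto_add_comap_im (n : ℕ) :
    Tendsto (fun z : ℂ ↦ z + n) (comap Complex.im atTop) (comap Complex.im atTop) := by
  simpa using tendsto_affine_comap_im (r := 1) one_pos n

theorem tendsto_qParam_comap_im {h : ℝ} (hh : 0 < h) :
    Tendsto (Function.Periodic.qParam h) (comap Complex.im atTop) (𝓝 0) :=
  (Function.Periodic.qParam_tendsto hh).mono_right nhdsWithin_le_nhds

theorem mul_eq_zero_on_upperHalfPlane {f g : ℂ → ℂ} (hf : DifferentiableOn ℂ f upperHalfPlaneSet)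
    (hg : DifferentiableOn ℂ g upperHalfPlaneSet) (h : ∀ z : ℂ, 0 < z.im → f z * g z = 0) :
    (∀ z : ℂ, 0 < z.im → f z = 0) ∨ ∀ z : ℂ, 0 < z.im → g z = 0 :=
  AnalyticOnNhd.eq_zero_or_eq_zero_of_mul_eq_zero
    (hf.analyticOnNhd isOpen_upperHalfPlaneSet) (hg.analyticOnNhd isOpen_upperHalfPlaneSet)
    h (convex_halfSpace_im_gt 0).isPreconnected

/-! ### A vanishing principle in level one -/

/-- A function on the upper half-plane with the transformation laws of a form of level one and
weight `k < 12` which tends to `0` at `i∞` is a cusp form, hence zero. -/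
theorem eq_zero_of_levelOne {k : ℕ} (hk : k < 12) {f : ℂ → ℂ}
    (hd : DifferentiableOn ℂ f upperHalfPlaneSet)
    (hT : ∀ z : ℂ, 0 < z.im → f (z + 1) = f z)
    (hS : ∀ z : ℂ, 0 < z.im → f (-1 / z) = z ^ k * f z)
    (h0 : Tendsto f (comap Complex.im atTop) (𝓝 0)) {z : ℂ} (hz : 0 < z.im) : f z = 0 := by
  set g : ℍ → ℂ := fun τ ↦ f τ with hg
  have gS : g ∣[(k : ℤ)] ModularGroup.S = g := by
    ext τ
    have h := hS τ τ.im_pos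
    have : (τ : ℂ) ≠ 0 := τ.ne_zero
    rw [show (-1 : ℂ) / τ = (-(τ : ℂ))⁻¹ by field_simp] at h
    rw [SL_slash_apply, UpperHalfPlane.modular_S_smul, ModularGroup.denom_S]
    simp only [hg, h, zpow_neg, zpow_natCast]
    field_simp
  have gT : g ∣[(k : ℤ)] ModularGroup.T = g := by
    ext τ
    have hden : denom (ModularGroup.T : GL (Fin 2) ℝ) τ = 1 := by
      refine (ModularGroup.denom_apply _ _).trans ?_
      simp [ModularGroup.T]
    have h := hT τ τ.im_pos
    rw [add_comm] at h
    rw [SL_slash_apply, modular_T_smul, hden]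
    simp [hg, h]
  have gz : IsZeroAtImInfty g := h0.comp tendsto_coe_atImInfty
  let F : CuspForm 𝒮ℒ (k : ℤ) :=
    { toFun := g
      slash_action_eq' := by
        rintro A ⟨A, rfl⟩
        exact SlashInvariantForm.slash_action_generators_SL2Z gS gT A
      holo' := by
        rw [UpperHalfPlane.mdifferentiable_iff]
        exact hd.congr fun z hz ↦ by simp [hg, ofComplex_apply_of_im_pos hz]
      zero_at_cusps' := by
        intro c hc
        rw [Subgroup.IsArithmetic.isCusp_iff_isCusp_SL2Z] at hc
        rw [OnePoint.isZeroAt_iff_forall_SL2Z hc]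
        intro γ _
        rw [SlashInvariantForm.slash_action_generators_SL2Z gS gT]
        exact gz }
  have hF : F = 0 := rank_zero_iff_forall_zero.mp
    (CuspForm.rank_eq_zero_of_weight_lt_twelve (by exact_mod_cast hk)) F
  exact congrArg (fun G : CuspForm 𝒮ℒ (k : ℤ) ↦ G ⟨z, hz⟩) hF

/-! ### The Dedekind eta function -/

theorem csqrt_sq (z : ℂ) : Complex.sqrt z ^ 2 = z := by
  simp [Complex.sqrt]

theorem csqrt_ofReal_mul {r : ℝ} (hr : 0 < r) {z : ℂ} (hz : z ≠ 0) :
    Complex.sqrt (r * z) = Real.sqrt r * Complex.sqrt z := by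
  rw [_root_.sqrt_eq_exp (by simp [hr.ne', hz]), _root_.sqrt_eq_exp hz,
    Complex.log_ofReal_mul hr hz, Real.sqrt_eq_rpow, add_div, Complex.exp_add,
    Real.rpow_def_of_pos hr]
  push_cast
  congr 2
  ring

theorem eta_ne_zero_of_im_pos {z : ℂ} (hz : 0 < z.im) : η z ≠ 0 := eta_ne_zero hz

theorem differentiableAt_eta {z : ℂ} (hz : 0 < z.im) : DifferentiableAt ℂ η z :=
  differentiableAt_eta_of_mem_upperHalfPlaneSet hz

theorem differentiableAt_eta_mul (n : ℕ) (hn : 0 < n) {z : ℂ} (hz : 0 < z.im) :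
    DifferentiableAt ℂ (fun z ↦ η (n * z)) z :=
  (differentiableAt_eta (im_mul_pos hz hn)).comp (f := fun z : ℂ ↦ n * z) z (by fun_prop)

theorem eta_add_one (z : ℂ) : η (z + 1) = Complex.exp (Real.pi * Complex.I / 12) * η z := by
  have h1 : Function.Periodic.qParam 24 (z + 1) =
      Complex.exp (Real.pi * Complex.I / 12) * Function.Periodic.qParam 24 z := by
    rw [Function.Periodic.qParam, Function.Periodic.qParam, ← Complex.exp_add]
    congr 1
    push_cast
    ring
  have h2 : ∀ n, eta_q n (z + 1) = eta_q n z := fun n ↦ by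
    rw [eta_q_eq_pow, eta_q_eq_pow, mul_add, Complex.exp_add, mul_one, Complex.exp_two_pi_mul_I,
      mul_one]
  simp only [ModularForm.eta, h1, h2, mul_assoc]

theorem eta_neg_inv {z : ℂ} (hz : 0 < z.im) :
    η (-1 / z) = (Complex.sqrt Complex.I)⁻¹ * (Complex.sqrt z * η z) := by
  simpa using eta_comp_eq_csqrt_I_inv (show z ∈ upperHalfPlaneSet from hz)

theorem eta_pow_four_neg_inv {z : ℂ} (hz : 0 < z.im) : η (-1 / z) ^ 4 = -z ^ 2 * η z ^ 4 := by
  have h1 := csqrt_sq z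
  have h2 := csqrt_sq Complex.I
  have h3 := Complex.I_sq
  rw [eta_neg_inv hz, mul_pow, mul_pow, inv_pow, show Complex.sqrt Complex.I ^ 4 = -1 by
    rw [show (4 : ℕ) = 2 * 2 by rfl, pow_mul, h2, h3], show Complex.sqrt z ^ 4 = z ^ 2 by
    rw [show (4 : ℕ) = 2 * 2 by rfl, pow_mul, h1]]
  norm_num

theorem eta_pow_eight_neg_inv {z : ℂ} (hz : 0 < z.im) : η (-1 / z) ^ 8 = z ^ 4 * η z ^ 8 := by
  linear_combination (η (-1 / z) ^ 4 - z ^ 2 * η z ^ 4) * eta_pow_four_neg_inv hz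

theorem eta_pow_twelve_neg_inv {z : ℂ} (hz : 0 < z.im) :
    η (-1 / z) ^ 12 = -z ^ 6 * η z ^ 12 := by
  linear_combination η (-1 / z) ^ 4 * eta_pow_eight_neg_inv hz +
    z ^ 4 * η z ^ 8 * eta_pow_four_neg_inv hz

theorem eta_pow_twelve_add_one (z : ℂ) : η (z + 1) ^ 12 = -η z ^ 12 := by
  rw [eta_add_one, mul_pow, ← Complex.exp_nat_mul,
    show ((12 : ℕ) : ℂ) * (Real.pi * Complex.I / 12) = Real.pi * Complex.I by push_cast; ring,
    Complex.exp_pi_mul_I]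
  ring

theorem tendsto_eta_tprod :
    Tendsto (fun z : ℂ ↦ ∏' n, (1 - eta_q n z)) (comap Complex.im atTop) (𝓝 1) := by
  have htprod : Tendsto (fun q : ℂ ↦ ∏' (n : ℕ), (1 - q ^ (n + 1))) (𝓝 0) (𝓝 1) := by
    have h := (differentiableOn_tprod_one_sub_pow.differentiableAt
      (Metric.ball_mem_nhds 0 one_pos)).continuousAt.tendsto
    simpa using h
  exact htprod.comp ((Function.Periodic.qParam_tendsto one_pos).mono_right nhdsWithin_le_nhds)

theorem tendsto_eta : Tendsto η (comap Complex.im atTop) (𝓝 0) := by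
  have := (tendsto_qParam_comap_im (h := 24) (by norm_num)).mul tendsto_eta_tprod
  rw [zero_mul] at this
  exact this

/-! ### Eisenstein series of level one -/

/-- The normalised Eisenstein series `E_k` of level one as a function on `ℂ`; its values outside the
upper half-plane are junk. -/
noncomputable def eisC {k : ℕ} (hk : 3 ≤ k) (z : ℂ) : ℂ := E hk (ofComplex z)

theorem eisC_differentiableOn {k : ℕ} (hk : 3 ≤ k) :
    DifferentiableOn ℂ (eisC hk) upperHalfPlaneSet :=
  UpperHalfPlane.mdifferentiable_iff.mp (ModularFormClass.holo (E hk))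

theorem eisC_add_one {k : ℕ} (hk : 3 ≤ k) (z : ℂ) : eisC hk (z + 1) = eisC hk z := by
  simpa [eisC] using
    SlashInvariantFormClass.periodic_comp_ofComplex (E hk) one_mem_strictPeriods_SL z

theorem eisC_neg_inv {k : ℕ} (hk : 3 ≤ k) {z : ℂ} (hz : 0 < z.im) :
    eisC hk (-1 / z) = z ^ k * eisC hk z := by
  have h : (E hk : ℍ → ℂ) ∣[(k : ℤ)] ModularGroup.S = E hk :=
    SlashInvariantFormClass.slash_action_eq (E hk) _ ⟨ModularGroup.S, rfl⟩
  have h' := congrFun h ⟨z, hz⟩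
  have hz0 := ne_zero_of_im_pos hz
  rw [SL_slash_apply, UpperHalfPlane.modular_S_smul, ModularGroup.denom_S] at h'
  rw [eisC, eisC, ofComplex_apply_of_im_pos hz, ofComplex_apply_of_im_pos (neg_one_div_im_pos hz),
    ← h', mul_comm (z ^ k)]
  simp only [zpow_neg, zpow_natCast]
  rw [inv_mul_cancel_right₀ (pow_ne_zero _ hz0)]
  congr 2
  rw [neg_div, one_div, inv_neg]

theorem eisC_hasSum {k : ℕ} (hk : 3 ≤ k) (hk2 : Even k) {z : ℂ} (hz : 0 < z.im) :
    HasSum (fun m : ℕ ↦ (if m = 0 then 1 else -(2 * k / bernoulli k : ℂ) *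
      (ArithmeticFunction.sigma (k - 1) m)) * Complex.exp (2 * Real.pi * Complex.I * z) ^ m)
      (eisC hk z) := by
  have := ModularForm.hasSum_qExpansion (E hk) one_pos one_mem_strictPeriods_SL ⟨z, hz⟩
  rw [eisC, ofComplex_apply_of_im_pos hz]
  simpa [E_qExpansion_coeff hk hk2, Function.Periodic.qParam] using this

theorem tendsto_eisC {k : ℕ} (hk : 3 ≤ k) (hk2 : Even k) :
    Tendsto (eisC hk) (comap Complex.im atTop) (𝓝 1) := by
  have hc := (ModularFormClass.analyticAt_cuspFunction_zero (E hk) one_pos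
    one_mem_strictPeriods_SL).continuousAt.tendsto
  have h0 : cuspFunction 1 (E hk) 0 = 1 := by
    rw [← E_qExpansion_coeff_zero hk hk2]
    simp [qExpansion_coeff]
  rw [h0] at hc
  refine (hc.comp (tendsto_qParam_comap_im one_pos)).congr' ?_
  filter_upwards [preimage_mem_comap (Ioi_mem_atTop 0)] with z hz
  rw [eisC, ofComplex_apply_of_im_pos hz]
  exact SlashInvariantFormClass.eq_cuspFunction (E hk) ⟨z, hz⟩ one_mem_strictPeriods_SL one_ne_zero

theorem eisC_eight {z : ℂ} (hz : 0 < z.im) :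
    eisC (by norm_num : 3 ≤ 8) z = eisC (by norm_num : 3 ≤ 4) z ^ 2 := by
  rw [← sub_eq_zero]
  refine eq_zero_of_levelOne (k := 8) (by norm_num)
    (f := fun z ↦ eisC (by norm_num : 3 ≤ 8) z - eisC (by norm_num : 3 ≤ 4) z ^ 2) ?_ ?_ ?_ ?_ hz
  · exact (eisC_differentiableOn _).sub ((eisC_differentiableOn _).pow 2)
  · intro z _
    simp only [eisC_add_one]
  · intro z hz
    simp only [eisC_neg_inv _ hz]
    ring
  · simpa using (tendsto_eisC (by norm_num : 3 ≤ 8) ⟨4, rfl⟩).sub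
      ((tendsto_eisC (by norm_num : 3 ≤ 4) ⟨2, rfl⟩).pow 2)

/-! ### Level two -/

/-- The fourth power of the theta function `θ₄` (in the nome `e^{πiz}`), as an eta quotient. -/
noncomputable def phi2 (z : ℂ) : ℂ := η (z / 2) ^ 8 / η z ^ 4

/-- One sixteenth of the fourth power of the theta function `θ₂` (in the nome `e^{πiz}`), as an eta
quotient. -/
noncomputable def psi2 (z : ℂ) : ℂ := η (2 * z) ^ 8 / η z ^ 4

theorem differentiableOn_phi2 : DifferentiableOn ℂ phi2 upperHalfPlaneSet := by
  intro z hz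
  have h1 : DifferentiableAt ℂ (fun z : ℂ ↦ η (z / 2)) z :=
    (differentiableAt_eta (im_half_pos hz)).comp (f := fun z : ℂ ↦ z / 2) z (by fun_prop)
  exact ((h1.pow 8).div ((differentiableAt_eta hz).pow 4)
    (pow_ne_zero _ (eta_ne_zero hz))).differentiableWithinAt

theorem differentiableOn_psi2 : DifferentiableOn ℂ psi2 upperHalfPlaneSet := by
  intro z hz
  have h1 : DifferentiableAt ℂ (fun z : ℂ ↦ η (2 * z)) z :=
    (differentiableAt_eta (im_two_mul_pos hz)).comp z (by fun_prop)
  exact ((h1.pow 8).div ((differentiableAt_eta hz).pow 4)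
    (pow_ne_zero _ (eta_ne_zero hz))).differentiableWithinAt

theorem phi2_neg_inv {z : ℂ} (hz : 0 < z.im) : phi2 (-1 / z) = -16 * z ^ 2 * psi2 z := by
  have h := ne_zero_of_im_pos hz
  have h0 := eta_ne_zero_of_im_pos hz
  rw [phi2, psi2, show -1 / z / 2 = -1 / (2 * z) by field_simp, eta_pow_four_neg_inv hz,
    eta_pow_eight_neg_inv (im_two_mul_pos hz)]
  field_simp
  ring

theorem psi2_neg_inv {z : ℂ} (hz : 0 < z.im) : psi2 (-1 / z) = -z ^ 2 / 16 * phi2 z := by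
  have h := ne_zero_of_im_pos hz
  have h1 := phi2_neg_inv (neg_one_div_im_pos hz)
  rw [show -1 / (-1 / z) = z by field_simp] at h1
  rw [h1]
  field_simp

theorem psi2_add_one (z : ℂ) : psi2 (z + 1) = -psi2 z := by
  rw [psi2, psi2, show 2 * (z + 1) = 2 * z + 1 + 1 by ring, eta_add_one, eta_add_one, eta_add_one]
  have h := Complex.exp_ne_zero (Real.pi * Complex.I / 12)
  have h12 : Complex.exp (Real.pi * Complex.I / 12) ^ 12 = -1 := by
    rw [← Complex.exp_nat_mul, show ((12 : ℕ) : ℂ) * (Real.pi * Complex.I / 12) =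
      Real.pi * Complex.I by push_cast; ring, Complex.exp_pi_mul_I]
  rw [← mul_assoc, mul_pow, mul_pow, mul_pow, show ∀ x : ℂ, x ^ 8 * x ^ 8 = x ^ 4 * x ^ 12 by
    intro x; ring, h12, mul_assoc, mul_div_mul_left _ _ (pow_ne_zero 4 h)]
  ring

theorem phi2_add_two (z : ℂ) : phi2 (z + 1 + 1) = phi2 z := by
  rw [phi2, phi2, show (z + 1 + 1) / 2 = z / 2 + 1 by ring, eta_add_one, eta_add_one, eta_add_one]
  rw [← mul_assoc, mul_pow, mul_pow, mul_pow, ← pow_add]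
  exact mul_div_mul_left _ _ (pow_ne_zero _ (Complex.exp_ne_zero _))

theorem tendsto_phi2 : Tendsto phi2 (comap Complex.im atTop) (𝓝 1) := by
  have h := ((tendsto_eta_tprod.comp (tendsto_div_comap_im two_pos)).pow 8).div
    (tendsto_eta_tprod.pow 4) (by simp)
  rw [one_pow, one_pow, div_one] at h
  refine h.congr fun z ↦ ?_
  have hq : Function.Periodic.qParam 24 (z / 2) ^ 8 = Function.Periodic.qParam 24 z ^ 4 := by
    rw [Function.Periodic.qParam, Function.Periodic.qParam, ← Complex.exp_nat_mul,
      ← Complex.exp_nat_mul]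
    congr 1
    push_cast
    ring
  simp only [phi2, ModularForm.eta, mul_pow, hq, Function.comp]
  rw [mul_div_mul_left _ _ (pow_ne_zero _ (Function.Periodic.qParam_ne_zero _))]
  simp

theorem tendsto_psi2_div_eta : Tendsto (fun z ↦ psi2 z / η z ^ 12) (comap Complex.im atTop)
    (𝓝 1) := by
  have h := ((tendsto_eta_tprod.comp (tendsto_mul_comap_im two_pos)).pow 8).div
    (tendsto_eta_tprod.pow 16) (by simp)
  rw [one_pow, one_pow, div_one] at h
  refine h.congr fun z ↦ ?_
  have hq : Function.Periodic.qParam 24 (2 * z) ^ 8 = Function.Periodic.qParam 24 z ^ 16 := by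
    rw [Function.Periodic.qParam, Function.Periodic.qParam, ← Complex.exp_nat_mul,
      ← Complex.exp_nat_mul]
    congr 1
    push_cast
    ring
  simp only [psi2, ModularForm.eta, mul_pow, hq, Function.comp, div_div]
  rw [mul_mul_mul_comm, ← pow_add, ← pow_add,
    mul_div_mul_left _ _ (pow_ne_zero _ (Function.Periodic.qParam_ne_zero _))]
  simp

theorem tendsto_psi2 : Tendsto psi2 (comap Complex.im atTop) (𝓝 0) := by
  have h := tendsto_psi2_div_eta.mul (tendsto_eta.pow 12)
  rw [zero_pow (by norm_num), mul_zero] at h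
  refine h.congr' ?_
  filter_upwards [preimage_mem_comap (Ioi_mem_atTop 0)] with z hz
  exact div_mul_cancel₀ _ (pow_ne_zero _ (eta_ne_zero hz))

/-- The relation `TS = S T⁻¹ S T⁻¹` between the standard generators of `PSL₂(ℤ)` reduces this to
the laws already known. -/
theorem phi2_neg_inv_add_one {z : ℂ} (hz : 0 < z.im) :
    phi2 (-1 / z + 1) = -z ^ 2 * phi2 (z + 1) := by
  have h := ne_zero_of_im_pos hz
  have hz' : 0 < (z - 1).im := by simpa using hz
  have h' := ne_zero_of_im_pos hz'
  have hw : 0 < (-1 / z + 1).im := im_add_one_pos (neg_one_div_im_pos hz)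
  have hw' := ne_zero_of_im_pos hw
  have h1 := psi2_neg_inv hw
  have h2 := psi2_add_one (-1 / (-1 / z + 1))
  have h3 := psi2_neg_inv hz'
  have h4 := phi2_add_two (z - 1)
  rw [show z - 1 + 1 + 1 = z + 1 by ring] at h4
  rw [show -1 / (-1 / z + 1) + 1 = -1 / (z - 1) by
    have : -1 + z ≠ 0 := by rwa [neg_add_eq_sub]
    field_simp
    ring, h3, h1] at h2
  rw [h4]
  have h5 : (-1 / z + 1) ^ 2 * phi2 (-1 / z + 1) = -(z - 1) ^ 2 * phi2 (z - 1) := by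
    linear_combination -16 * h2
  have h6 : -1 / z + 1 = (z - 1) / z := by field_simp; ring
  rw [h6] at h5 ⊢
  rw [div_pow] at h5
  field_simp at h5
  linear_combination h5

/-- Jacobi's identity `θ₃^4 = θ₄^4 + θ₂^4`. -/
theorem phi2_add_one {z : ℂ} (hz : 0 < z.im) : phi2 (z + 1) = phi2 z + 16 * psi2 z := by
  have key : (phi2 (z + 1) - phi2 z - 16 * psi2 z) * η z ^ 12 = 0 := by
    refine eq_zero_of_levelOne (k := 8) (by norm_num)
      -- the factor `η^12` has the same signs under `z ↦ z + 1` and `z ↦ -1/z` as the difference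
      (f := fun z ↦ (phi2 (z + 1) - phi2 z - 16 * psi2 z) * η z ^ 12) ?_ ?_ ?_ ?_ hz
    · have h1 : DifferentiableOn ℂ (fun z ↦ phi2 (z + 1)) upperHalfPlaneSet :=
        differentiableOn_phi2.comp (by fun_prop) fun z hz ↦ im_add_one_pos hz
      exact ((h1.sub differentiableOn_phi2).sub (differentiableOn_psi2.const_mul 16)).mul
        (fun z hz ↦ ((differentiableAt_eta hz).pow 12).differentiableWithinAt)
    · intro z _
      simp only [phi2_add_two, psi2_add_one, eta_pow_twelve_add_one]
      ring
    · intro z hz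
      simp only [phi2_neg_inv_add_one hz, phi2_neg_inv hz, psi2_neg_inv hz,
        eta_pow_twelve_neg_inv hz]
      ring
    · have h1 := (((tendsto_phi2.comp (tendsto_add_comap_im 1)).sub tendsto_phi2).sub
        (tendsto_psi2.const_mul 16)).mul (tendsto_eta.pow 12)
      simpa [Function.comp_def] using h1
  rcases mul_eq_zero.mp key with h | h
  · linear_combination h
  · exact absurd h (pow_ne_zero _ (eta_ne_zero hz))

/-- The product formula `θ₂ θ₃ θ₄ = 2 η^3`, raised to the fourth power. -/
theorem eta_pow_twelve_eq {z : ℂ} (hz : 0 < z.im) :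
    η z ^ 12 = phi2 z * psi2 z * (phi2 z + 16 * psi2 z) := by
  have key : phi2 z * (phi2 z + 16 * psi2 z) * (psi2 z / η z ^ 12) - 1 = 0 := by
    refine eq_zero_of_levelOne (k := 0) (by norm_num)
      (f := fun z ↦ phi2 z * (phi2 z + 16 * psi2 z) * (psi2 z / η z ^ 12) - 1) ?_ ?_ ?_ ?_ hz
    · exact ((differentiableOn_phi2.mul (differentiableOn_phi2.add
        (differentiableOn_psi2.const_mul 16))).mul (differentiableOn_psi2.div
          (fun z hz ↦ ((differentiableAt_eta hz).pow 12).differentiableWithinAt)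
          fun z hz ↦ pow_ne_zero _ (eta_ne_zero hz))).sub_const 1
    · intro z hz
      simp only [phi2_add_one hz, psi2_add_one, eta_pow_twelve_add_one]
      ring
    · intro z hz
      have h := ne_zero_of_im_pos hz
      have h' := eta_ne_zero_of_im_pos hz
      simp only [phi2_neg_inv hz, psi2_neg_inv hz, eta_pow_twelve_neg_inv hz]
      field_simp
      ring
    · have h1 := ((tendsto_phi2.mul (tendsto_phi2.add
        (tendsto_psi2.const_mul 16))).mul tendsto_psi2_div_eta).sub_const 1
      simpa using h1
  have h' := eta_ne_zero_of_im_pos hz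
  field_simp at key
  linear_combination -key

/-- The form `(θ₃^4 + θ₄^4) / 2` of weight two for `Γ₀(2)`. -/
noncomputable def U2 (z : ℂ) : ℂ := phi2 z + 8 * psi2 z

theorem U2_add_one {z : ℂ} (hz : 0 < z.im) : U2 (z + 1) = U2 z := by
  rw [U2, U2, phi2_add_one hz, psi2_add_one]
  ring

theorem U2_neg_inv {z : ℂ} (hz : 0 < z.im) :
    U2 (-1 / z) = -z ^ 2 / 2 * (U2 z + 24 * psi2 z) := by
  rw [U2, U2, phi2_neg_inv hz, psi2_neg_inv hz]
  ring

theorem differentiableOn_U2 : DifferentiableOn ℂ U2 upperHalfPlaneSet :=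
  differentiableOn_phi2.add (differentiableOn_psi2.const_mul 8)

theorem tendsto_U2 : Tendsto U2 (comap Complex.im atTop) (𝓝 1) := by
  have h := tendsto_phi2.add (tendsto_psi2.const_mul 8)
  rw [mul_zero, add_zero] at h
  exact h

/-- With `u = (z - 1) / 2` the argument on the left is `u / (2u + 1)`, the image of `u` under an
element of `Γ₀(2)`, which is decomposed as `u ↦ -1/u ↦ -1/u - 2 ↦ -1/(-1/u - 2)`. -/
theorem U2_neg_inv_add_one_half {z : ℂ} (hz : 0 < z.im) :
    U2 ((-1 / z + 1) / 2) = z ^ 2 * U2 ((z + 1) / 2) := by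
  have h := ne_zero_of_im_pos hz
  have hu : 0 < ((z - 1) / 2).im := im_half_pos (by simpa using hz)
  set u := (z - 1) / 2 with hu'
  have hz' : z = 2 * u + 1 := by rw [hu']; ring
  have h0 := ne_zero_of_im_pos hu
  have hv0 := neg_one_div_im_pos hu
  have hv : 0 < (-1 / u - 2).im := by simpa using hv0
  have hv' := ne_zero_of_im_pos hv
  have e1 : -1 / (-1 / u - 2) = (-1 / z + 1) / 2 := by
    have hv2 : -1 / u - 2 = -z / u := by
      rw [hz']
      field_simp
      ring
    rw [hv2, hu']
    have : z - 1 ≠ 0 := by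
      intro h'
      rw [hu', h', zero_div] at h0
      exact h0 rfl
    field_simp
    ring
  have e2 := U2_neg_inv hv
  have e3 := phi2_add_two (-1 / u - 2)
  have e4 := psi2_add_one (-1 / u - 2 + 1)
  rw [psi2_add_one (-1 / u - 2), neg_neg] at e4
  rw [show -1 / u - 2 + 1 + 1 = -1 / u by ring] at e3 e4
  have e5 := U2_add_one hu
  rw [show u + 1 = (z + 1) / 2 by rw [hu']; ring] at e5
  rw [← e1, e2, e5, U2, ← e3, ← e4, phi2_neg_inv hu, psi2_neg_inv hu, U2, hz']
  field_simp
  ring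

/-- The difference `D` of the two sides is a form for `Γ₀(2)`; its transforms `D0`, `D1` belong to the
other cosets, and `D D0 D1` is of level one and weight six. -/
theorem U2_eq {z : ℂ} (hz : 0 < z.im) : U2 z = phi2 (2 * z) + 32 * psi2 (2 * z) := by
  let D : ℂ → ℂ := fun z ↦ phi2 (2 * z) + 32 * psi2 (2 * z) - U2 z
  let D0 : ℂ → ℂ := fun z ↦ U2 (z / 2) - U2 z - 24 * psi2 z
  let D1 : ℂ → ℂ := fun z ↦ U2 ((z + 1) / 2) - U2 z + 24 * psi2 z
  have hD : DifferentiableOn ℂ D upperHalfPlaneSet :=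
    ((differentiableOn_phi2.comp (by fun_prop) fun z hz ↦ im_two_mul_pos hz).add
      ((differentiableOn_psi2.comp (by fun_prop) fun z hz ↦ im_two_mul_pos hz).const_mul 32)).sub
      differentiableOn_U2
  have hD0 : DifferentiableOn ℂ D0 upperHalfPlaneSet :=
    ((differentiableOn_U2.comp (by fun_prop) fun z hz ↦ im_half_pos hz).sub
      differentiableOn_U2).sub (differentiableOn_psi2.const_mul 24)
  have hD1 : DifferentiableOn ℂ D1 upperHalfPlaneSet :=
    ((differentiableOn_U2.comp (by fun_prop) fun z hz ↦ im_half_pos (im_add_one_pos hz)).sub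
      differentiableOn_U2).add (differentiableOn_psi2.const_mul 24)
  have sD : ∀ z : ℂ, 0 < z.im → D (-1 / z) = -z ^ 2 / 2 * D0 z := by
    intro z hz
    have h := ne_zero_of_im_pos hz
    simp only [D, D0]
    rw [show 2 * (-1 / z) = -1 / (z / 2) by field_simp, phi2_neg_inv (im_half_pos hz),
      psi2_neg_inv (im_half_pos hz), U2_neg_inv hz]
    simp only [U2]
    ring
  have sD0 : ∀ z : ℂ, 0 < z.im → D0 (-1 / z) = -2 * z ^ 2 * D z := by
    intro z hz
    have h := ne_zero_of_im_pos hz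
    have h1 := sD _ (neg_one_div_im_pos hz)
    rw [show -1 / (-1 / z) = z by field_simp] at h1
    rw [h1]
    field_simp
  have sD1 : ∀ z : ℂ, 0 < z.im → D1 (-1 / z) = z ^ 2 * D1 z := by
    intro z hz
    simp only [D1]
    rw [U2_neg_inv_add_one_half hz, U2_neg_inv hz, psi2_neg_inv hz]
    simp only [U2]
    ring
  have tD0 : ∀ z : ℂ, 0 < z.im → D0 (z + 1) = D1 z := by
    intro z hz
    simp only [D0, D1]
    rw [U2_add_one hz, psi2_add_one]
    ring
  have tD1 : ∀ z : ℂ, 0 < z.im → D1 (z + 1) = D0 z := by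
    intro z hz
    simp only [D0, D1]
    rw [U2_add_one hz, psi2_add_one, show (z + 1 + 1) / 2 = z / 2 + 1 by ring,
      U2_add_one (im_half_pos hz)]
    ring
  have tD : ∀ z : ℂ, 0 < z.im → D (z + 1) = D z := by
    intro z hz
    have h2 := im_two_mul_pos hz
    simp only [D]
    rw [U2_add_one hz, mul_add, mul_one, show 2 * z + 2 = 2 * z + 1 + 1 by ring, phi2_add_two,
      psi2_add_one, psi2_add_one]
    ring
  have key : ∀ z : ℂ, 0 < z.im → D z * (D0 z * D1 z) = 0 := by
    intro z hz
    refine eq_zero_of_levelOne (k := 6) (by norm_num) (f := fun z ↦ D z * (D0 z * D1 z))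
      (hD.mul (hD0.mul hD1)) ?_ ?_ ?_ hz
    · intro z hz
      simp only [tD z hz, tD0 z hz, tD1 z hz]
      ring
    · intro z hz
      simp only [sD z hz, sD0 z hz, sD1 z hz]
      ring
    · have l0 := ((tendsto_phi2.comp (tendsto_mul_comap_im two_pos)).add
        ((tendsto_psi2.comp (tendsto_mul_comap_im two_pos)).const_mul 32)).sub tendsto_U2
      have l1 := ((tendsto_U2.comp (tendsto_div_comap_im two_pos)).sub tendsto_U2).sub
        (tendsto_psi2.const_mul 24)
      have l2 := ((tendsto_U2.comp ((tendsto_div_comap_im two_pos).comp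
        (tendsto_add_comap_im 1))).sub tendsto_U2).add (tendsto_psi2.const_mul 24)
      simpa [Function.comp_def] using l0.mul (l1.mul l2)
  have d0 : (∀ z : ℂ, 0 < z.im → D0 z = 0) → ∀ z : ℂ, 0 < z.im → D z = 0 := by
    intro H z hz
    have h := ne_zero_of_im_pos hz
    have h1 := sD0 z hz
    rw [H _ (neg_one_div_im_pos hz)] at h1
    simpa [h] using h1.symm
  have d : ∀ z : ℂ, 0 < z.im → D z = 0 := by
    rcases mul_eq_zero_on_upperHalfPlane hD (hD0.mul hD1) key with H | H
    · exact H
    · rcases mul_eq_zero_on_upperHalfPlane hD0 hD1 H with H | H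
      · exact d0 H
      · exact d0 fun z hz ↦ by rw [← tD1 z hz, H _ (im_add_one_pos hz)]
  linear_combination -d z hz

theorem eisC_four_eq_level_two {z : ℂ} (hz : 0 < z.im) : eisC (by norm_num : 3 ≤ 4) z =
    phi2 z ^ 2 + 16 * phi2 z * psi2 z + 256 * psi2 z ^ 2 := by
  rw [← sub_eq_zero]
  refine eq_zero_of_levelOne (k := 4) (by norm_num)
    (f := fun z ↦ eisC (by norm_num : 3 ≤ 4) z -
      (phi2 z ^ 2 + 16 * phi2 z * psi2 z + 256 * psi2 z ^ 2)) ?_ ?_ ?_ ?_ hz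
  · exact (eisC_differentiableOn _).sub (((differentiableOn_phi2.pow 2).add
      ((differentiableOn_phi2.const_mul 16).mul differentiableOn_psi2)).add
      ((differentiableOn_psi2.pow 2).const_mul 256))
  · intro z hz
    simp only [eisC_add_one, phi2_add_one hz, psi2_add_one]
    ring
  · intro z hz
    simp only [eisC_neg_inv _ hz, phi2_neg_inv hz, psi2_neg_inv hz]
    ring
  · simpa using (tendsto_eisC (by norm_num : 3 ≤ 4) ⟨2, rfl⟩).sub (((tendsto_phi2.pow 2).add
      ((tendsto_phi2.const_mul 16).mul tendsto_psi2)).add ((tendsto_psi2.pow 2).const_mul 256))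

theorem eisC_eight_sub_level_two {z : ℂ} (hz : 0 < z.im) :
    eisC (by norm_num : 3 ≤ 8) z - eisC (by norm_num : 3 ≤ 8) (2 * z) =
      480 * (η z ^ 8 * η (2 * z) ^ 8 + 136 *
      ((eisC (by norm_num : 3 ≤ 4) z - eisC (by norm_num : 3 ≤ 4) (2 * z)) / 240) ^ 2) := by
  have hz2 := im_two_mul_pos hz
  have n1 := eta_ne_zero_of_im_pos hz
  have n2 := eta_ne_zero_of_im_pos hz2
  have h12 := eta_pow_twelve_eq hz2
  have hU := U2_eq hz
  set b := phi2 (2 * z) with hb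
  set d := psi2 (2 * z) with hd
  have hb' : b * η (2 * z) ^ 4 = η z ^ 8 := by
    rw [hb, phi2, mul_div_cancel_left₀ z two_ne_zero]
    field_simp
  have hY : psi2 z ^ 2 = d * (b + 16 * d) := by
    have hb0 : b ≠ 0 := by
      intro h
      rw [h, zero_mul] at hb'
      exact pow_ne_zero _ n1 hb'.symm
    have : psi2 z ^ 2 * b = η (2 * z) ^ 12 := by
      have : psi2 z ^ 2 * η z ^ 8 = η (2 * z) ^ 16 := by
        rw [psi2]
        field_simp
      rw [← hb'] at this
      apply mul_right_cancel₀ (pow_ne_zero 4 n2)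
      linear_combination this
    apply mul_right_cancel₀ hb0
    rw [this, h12]
    ring
  have hΔ : η z ^ 8 * η (2 * z) ^ 8 = b ^ 2 * d * (b + 16 * d) := by
    rw [← hb']
    linear_combination b * h12
  have hX : phi2 z = b + 32 * d - 8 * psi2 z := by
    rw [← hU, U2]
    ring
  have h4 : eisC (by norm_num : 3 ≤ 4) z = (b + 32 * d) ^ 2 + 192 * (d * (b + 16 * d)) := by
    rw [eisC_four_eq_level_two hz, hX]
    linear_combination 192 * hY
  rw [eisC_eight hz, eisC_eight hz2, hΔ, h4, eisC_four_eq_level_two hz2]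
  ring

/-! ### Level three -/

/-- The primitive cube root of unity `e^{2πi/3}`. -/
noncomputable def zeta3 : ℂ := Complex.exp (2 * Real.pi * Complex.I / 3)

theorem zeta3_sq_add : zeta3 ^ 2 + zeta3 + 1 = 0 := by
  have h := (Complex.isPrimitiveRoot_exp 3 (by norm_num)).geom_sum_eq_zero (by norm_num)
  simp only [Finset.sum_range_succ, Finset.sum_range_zero] at h
  rw [zeta3]
  push_cast at h
  linear_combination h

theorem zeta3_pow_three : zeta3 ^ 3 = 1 := by
  linear_combination (zeta3 - 1) * zeta3_sq_add

theorem sqrt_three_mul_I : (Real.sqrt 3 : ℂ) * Complex.I = 2 * zeta3 + 1 := by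
  have h : (2 * Real.pi * Complex.I / 3 : ℂ) = ((2 * Real.pi / 3 : ℝ) : ℂ) * Complex.I := by
    push_cast
    ring
  have hc : Real.cos (2 * Real.pi / 3) = -(1 / 2) := by
    rw [show 2 * Real.pi / 3 = Real.pi - Real.pi / 3 by ring, Real.cos_pi_sub, Real.cos_pi_div_three]
  have hs : Real.sin (2 * Real.pi / 3) = Real.sqrt 3 / 2 := by
    rw [show 2 * Real.pi / 3 = Real.pi - Real.pi / 3 by ring, Real.sin_pi_sub, Real.sin_pi_div_three]
  rw [zeta3, h, Complex.exp_mul_I, ← Complex.ofReal_cos, ← Complex.ofReal_sin, hc, hs]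
  push_cast
  ring

/-- The value at `z / 3` of the cubic theta function `b(z) = η(z)^3 / η(3z)`. -/
noncomputable def phi3 (z : ℂ) : ℂ := η (z / 3) ^ 3 / η z

/-- One third of the cubic theta function `c(z) = 3 η(3z)^3 / η(z)`. -/
noncomputable def psi3 (z : ℂ) : ℂ := η (3 * z) ^ 3 / η z

theorem differentiableOn_phi3 : DifferentiableOn ℂ phi3 upperHalfPlaneSet := by
  intro z hz
  have h1 : DifferentiableAt ℂ (fun z : ℂ ↦ η (z / 3)) z :=
    (differentiableAt_eta (im_third_pos hz)).comp (f := fun z : ℂ ↦ z / 3) z (by fun_prop)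
  exact ((h1.pow 3).div (differentiableAt_eta hz) (eta_ne_zero hz)).differentiableWithinAt

theorem differentiableOn_psi3 : DifferentiableOn ℂ psi3 upperHalfPlaneSet := by
  intro z hz
  have h1 : DifferentiableAt ℂ (fun z : ℂ ↦ η (3 * z)) z :=
    (differentiableAt_eta (im_three_mul_pos hz)).comp z (by fun_prop)
  exact ((h1.pow 3).div (differentiableAt_eta hz) (eta_ne_zero hz)).differentiableWithinAt

/-- The constant is `-3 i √3`; the square roots in the law of `η` cancel up to `√3` and `i`. -/
theorem phi3_neg_inv {z : ℂ} (hz : 0 < z.im) :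
    phi3 (-1 / z) = -3 * (2 * zeta3 + 1) * z * psi3 z := by
  have h := ne_zero_of_im_pos hz
  have h0 := eta_ne_zero_of_im_pos hz
  have hI := csqrt_sq Complex.I
  have hzz := csqrt_sq z
  have hI0 : Complex.sqrt Complex.I ≠ 0 := by
    intro h
    rw [h, zero_pow two_ne_zero] at hI
    exact Complex.I_ne_zero hI.symm
  have hz0 : Complex.sqrt z ≠ 0 := by
    intro h'
    rw [h', zero_pow two_ne_zero] at hzz
    exact h hzz.symm
  have h3 : ((Real.sqrt 3 : ℝ) : ℂ) ^ 2 = 3 := by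
    rw [← Complex.ofReal_pow, Real.sq_sqrt (by norm_num)]
    norm_num
  have hs := csqrt_ofReal_mul (r := 3) (by norm_num) h
  push_cast at hs
  rw [phi3, psi3, show -1 / z / 3 = -1 / (3 * z) by field_simp, eta_neg_inv hz,
    eta_neg_inv (im_three_mul_pos hz), hs, ← sqrt_three_mul_I]
  have e : (Complex.sqrt Complex.I)⁻¹ ^ 2 = -Complex.I := by
    rw [inv_pow, hI, Complex.inv_I]
  have key : ((Complex.sqrt Complex.I)⁻¹ *
      (((Real.sqrt 3 : ℝ) : ℂ) * Complex.sqrt z * η (3 * z))) ^ 3 =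
      (-3 * ((Real.sqrt 3 : ℝ) * Complex.I) * z * (η (3 * z)) ^ 3) *
      ((Complex.sqrt Complex.I)⁻¹ * Complex.sqrt z) := by
    calc _ = (Complex.sqrt Complex.I)⁻¹ ^ 2 * ((Real.sqrt 3 : ℝ) : ℂ) ^ 2 * Complex.sqrt z ^ 2 *
          (Real.sqrt 3 : ℝ) * η (3 * z) ^ 3 * ((Complex.sqrt Complex.I)⁻¹ * Complex.sqrt z) := by ring
      _ = _ := by rw [e, h3, hzz]; ring
  rw [key]
  field_simp

theorem psi3_neg_inv {z : ℂ} (hz : 0 < z.im) :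
    psi3 (-1 / z) = -(2 * zeta3 + 1) * z / 9 * phi3 z := by
  have h := ne_zero_of_im_pos hz
  have h1 := phi3_neg_inv (neg_one_div_im_pos hz)
  rw [show -1 / (-1 / z) = z by field_simp] at h1
  rw [h1]
  generalize psi3 (-1 / z) = y
  field_simp
  linear_combination 12 * y * zeta3_sq_add

theorem exp_pow_eight_eq_zeta3 : Complex.exp (Real.pi * Complex.I / 12) ^ 8 = zeta3 := by
  rw [← Complex.exp_nat_mul, zeta3]
  congr 1
  push_cast
  ring

theorem eta_pow_eight_add_one (z : ℂ) : η (z + 1) ^ 8 = zeta3 * η z ^ 8 := by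
  rw [eta_add_one, mul_pow, exp_pow_eight_eq_zeta3]

theorem psi3_add_one (z : ℂ) : psi3 (z + 1) = zeta3 * psi3 z := by
  have h := Complex.exp_ne_zero (Real.pi * Complex.I / 12)
  rw [psi3, psi3, show 3 * (z + 1) = 3 * z + 1 + 1 + 1 by ring, eta_add_one, eta_add_one,
    eta_add_one, eta_add_one, ← exp_pow_eight_eq_zeta3]
  field_simp

theorem phi3_add_three (z : ℂ) : phi3 (z + 1 + 1 + 1) = phi3 z := by
  have h := Complex.exp_ne_zero (Real.pi * Complex.I / 12)
  rw [phi3, phi3, show (z + 1 + 1 + 1) / 3 = z / 3 + 1 by ring, eta_add_one, eta_add_one,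
    eta_add_one, eta_add_one]
  field_simp

theorem tendsto_phi3 : Tendsto phi3 (comap Complex.im atTop) (𝓝 1) := by
  have h := ((tendsto_eta_tprod.comp (tendsto_div_comap_im three_pos)).pow 3).div
    tendsto_eta_tprod (by simp)
  rw [one_pow, div_one] at h
  refine h.congr fun z ↦ ?_
  have hq : Function.Periodic.qParam 24 (z / 3) ^ 3 = Function.Periodic.qParam 24 z := by
    rw [Function.Periodic.qParam, Function.Periodic.qParam, ← Complex.exp_nat_mul]
    congr 1
    push_cast
    ring
  simp only [phi3, ModularForm.eta, mul_pow, hq, Function.comp]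
  rw [mul_div_mul_left _ _ (Function.Periodic.qParam_ne_zero _)]
  simp

theorem tendsto_psi3_div_eta : Tendsto (fun z ↦ psi3 z / η z ^ 8) (comap Complex.im atTop)
    (𝓝 1) := by
  have h := ((tendsto_eta_tprod.comp (tendsto_mul_comap_im three_pos)).pow 3).div
    (tendsto_eta_tprod.pow 9) (by simp)
  rw [one_pow, one_pow, div_one] at h
  refine h.congr fun z ↦ ?_
  have hq : Function.Periodic.qParam 24 (3 * z) ^ 3 = Function.Periodic.qParam 24 z ^ 9 := by
    rw [Function.Periodic.qParam, Function.Periodic.qParam, ← Complex.exp_nat_mul,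
      ← Complex.exp_nat_mul]
    congr 1
    push_cast
    ring
  simp only [psi3, ModularForm.eta, mul_pow, hq, Function.comp, div_div]
  rw [mul_mul_mul_comm, ← pow_succ', ← pow_succ',
    mul_div_mul_left _ _ (pow_ne_zero _ (Function.Periodic.qParam_ne_zero _))]
  simp

theorem tendsto_psi3 : Tendsto psi3 (comap Complex.im atTop) (𝓝 0) := by
  have h := tendsto_psi3_div_eta.mul (tendsto_eta.pow 8)
  rw [zero_pow (by norm_num), mul_zero] at h
  refine h.congr' ?_
  filter_upwards [preimage_mem_comap (Ioi_mem_atTop 0)] with z hz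
  exact div_mul_cancel₀ _ (pow_ne_zero _ (eta_ne_zero hz))

/-- As for `phi2_neg_inv_add_one`, this comes from the relation `TS = S T⁻¹ S T⁻¹` in `PSL₂(ℤ)`. -/
theorem phi3_neg_inv_add_one {z : ℂ} (hz : 0 < z.im) :
    phi3 (-1 / z + 1) = zeta3 ^ 2 * z * phi3 (z + 1 + 1) := by
  have h := ne_zero_of_im_pos hz
  have hz' : 0 < (z - 1).im := by simpa using hz
  have h' := ne_zero_of_im_pos hz'
  have hw : 0 < (-1 / z + 1).im := im_add_one_pos (neg_one_div_im_pos hz)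
  have hw' := ne_zero_of_im_pos hw
  have h1 := psi3_neg_inv hw
  have h2 := psi3_add_one (-1 / (-1 / z + 1))
  have h3 := psi3_neg_inv hz'
  have h4 := phi3_add_three (z - 1)
  rw [show z - 1 + 1 + 1 + 1 = z + 1 + 1 by ring] at h4
  have h6 : -1 / z + 1 = (z - 1) / z := by field_simp; ring
  rw [show -1 / (-1 / z + 1) + 1 = -1 / (z - 1) by
    rw [h6]
    field_simp
    ring, h3, h1] at h2
  rw [h4]
  have hs : 2 * zeta3 + 1 ≠ 0 := by
    intro h
    have : (2 * zeta3 + 1) ^ 2 = -3 := by linear_combination 4 * zeta3_sq_add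
    rw [h] at this
    norm_num at this
  rw [h6] at h2 ⊢
  have h7 : (z - 1) * phi3 (z - 1) = zeta3 * ((z - 1) / z * phi3 ((z - 1) / z)) := by
    apply mul_left_cancel₀ hs
    linear_combination -9 * h2
  field_simp at h7
  have hw3 := zeta3_pow_three
  linear_combination -zeta3 ^ 2 * h7 - phi3 ((z - 1) / z) * hw3

theorem phi3_neg_inv_add_two {z : ℂ} (hz : 0 < z.im) :
    phi3 (-1 / z + 1 + 1) = -zeta3 * z * phi3 (z + 1) := by
  have h := ne_zero_of_im_pos hz
  have h1 := phi3_neg_inv_add_one (neg_one_div_im_pos hz)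
  rw [show -1 / (-1 / z) = z by field_simp] at h1
  rw [h1]
  have hw3 := zeta3_pow_three
  generalize phi3 (-1 / z + 1 + 1) = y
  field_simp
  linear_combination -y * hw3

/-- The expansion of `φ` in powers of `e^{2πiz/3}` has no exponents congruent to `2` modulo `3`. The
left-hand side `A` and the combinations `B0`, `B1`, `B2` are permuted, up to constants, by
`z ↦ z + 1` and `z ↦ -1/z`, so that `A B0 B1 B2 η^8` is a cusp form of level one and weight
eight. -/
theorem phi3_trisection {z : ℂ} (hz : 0 < z.im) :
    phi3 z + zeta3 * phi3 (z + 1) + zeta3 ^ 2 * phi3 (z + 1 + 1) = 0 := by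
  have hw := zeta3_sq_add
  have hw3 := zeta3_pow_three
  let A : ℂ → ℂ := fun z ↦ phi3 z + zeta3 * phi3 (z + 1) + zeta3 ^ 2 * phi3 (z + 1 + 1)
  let B0 : ℂ → ℂ := fun z ↦ phi3 (z + 1) - phi3 (z + 1 + 1) + 3 * (2 * zeta3 + 1) * psi3 z
  let B1 : ℂ → ℂ := fun z ↦ phi3 (z + 1 + 1) - phi3 z + 3 * (2 * zeta3 + 1) * zeta3 * psi3 z
  let B2 : ℂ → ℂ := fun z ↦ phi3 z - phi3 (z + 1) + 3 * (2 * zeta3 + 1) * zeta3 ^ 2 * psi3 z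
  have d1 : DifferentiableOn ℂ (fun z ↦ phi3 (z + 1)) upperHalfPlaneSet :=
    differentiableOn_phi3.comp (by fun_prop) fun z hz ↦ im_add_one_pos hz
  have d2 : DifferentiableOn ℂ (fun z ↦ phi3 (z + 1 + 1)) upperHalfPlaneSet :=
    d1.comp (by fun_prop) fun z hz ↦ im_add_one_pos hz
  have hA : DifferentiableOn ℂ A upperHalfPlaneSet :=
    (differentiableOn_phi3.add (d1.const_mul _)).add (d2.const_mul _)
  have hB0 : DifferentiableOn ℂ B0 upperHalfPlaneSet :=
    (d1.sub d2).add (differentiableOn_psi3.const_mul _)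
  have hB1 : DifferentiableOn ℂ B1 upperHalfPlaneSet :=
    (d2.sub differentiableOn_phi3).add (differentiableOn_psi3.const_mul _)
  have hB2 : DifferentiableOn ℂ B2 upperHalfPlaneSet :=
    (differentiableOn_phi3.sub d1).add (differentiableOn_psi3.const_mul _)
  have sA : ∀ z : ℂ, 0 < z.im → A (-1 / z) = -z * B0 z := by
    intro z hz
    simp only [A, B0]
    rw [phi3_neg_inv hz, phi3_neg_inv_add_one hz, phi3_neg_inv_add_two hz]
    grind
  have sB0 : ∀ z : ℂ, 0 < z.im → B0 (-1 / z) = z * A z := by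
    intro z hz
    simp only [A, B0]
    rw [psi3_neg_inv hz, phi3_neg_inv_add_one hz, phi3_neg_inv_add_two hz]
    grind
  have sB1 : ∀ z : ℂ, 0 < z.im → B1 (-1 / z) = zeta3 * z * B2 z := by
    intro z hz
    simp only [B1, B2]
    rw [phi3_neg_inv hz, psi3_neg_inv hz, phi3_neg_inv_add_two hz]
    grind
  have sB2 : ∀ z : ℂ, 0 < z.im → B2 (-1 / z) = -zeta3 ^ 2 * z * B1 z := by
    intro z hz
    simp only [B1, B2]
    rw [phi3_neg_inv hz, psi3_neg_inv hz, phi3_neg_inv_add_one hz]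
    grind
  -- under `z ↦ z + 1` the product is multiplied by `ζ^2`, which the factor `ζ` of `η^8` cancels
  have tA : ∀ z, A (z + 1) = zeta3 ^ 2 * A z := by
    intro z
    simp only [A]
    rw [phi3_add_three]
    grind
  have tB0 : ∀ z, B0 (z + 1) = B1 z := by
    intro z
    simp only [B0, B1]
    rw [phi3_add_three, psi3_add_one]
    ring
  have tB1 : ∀ z, B1 (z + 1) = B2 z := by
    intro z
    simp only [B2, B1]
    rw [phi3_add_three, psi3_add_one]
    ring
  have tB2 : ∀ z, B2 (z + 1) = B0 z := by
    intro z
    simp only [B2, B0]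
    rw [psi3_add_one]
    grind
  have l1 : Tendsto (fun z ↦ phi3 (z + 1)) (comap Complex.im atTop) (𝓝 1) := by
    simpa [Function.comp_def] using tendsto_phi3.comp (tendsto_add_comap_im 1)
  have l2 : Tendsto (fun z ↦ phi3 (z + 1 + 1)) (comap Complex.im atTop) (𝓝 1) := by
    simpa [Function.comp_def] using l1.comp (tendsto_add_comap_im 1)
  have key : ∀ z : ℂ, 0 < z.im → A z * (B0 z * (B1 z * B2 z)) = 0 := by
    intro z hz
    refine (mul_eq_zero.mp ?_).resolve_right (pow_ne_zero 8 (eta_ne_zero hz))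
    refine eq_zero_of_levelOne (k := 8) (by norm_num)
      (f := fun z ↦ A z * (B0 z * (B1 z * B2 z)) * η z ^ 8)
      ((hA.mul (hB0.mul (hB1.mul hB2))).mul
        (fun z hz ↦ ((differentiableAt_eta hz).pow 8).differentiableWithinAt)) ?_ ?_ ?_ hz
    · intro z hz
      simp only [tA, tB0, tB1, tB2, eta_pow_eight_add_one]
      linear_combination A z * (B0 z * (B1 z * B2 z)) * η z ^ 8 * hw3
    · intro z hz
      simp only [sA z hz, sB0 z hz, sB1 z hz, sB2 z hz, eta_pow_eight_neg_inv hz]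
      linear_combination A z * (B0 z * (B1 z * B2 z)) * η z ^ 8 * z ^ 8 * hw3
    · have lA := (tendsto_phi3.add (l1.const_mul zeta3)).add (l2.const_mul (zeta3 ^ 2))
      have lB0 := (l1.sub l2).add (tendsto_psi3.const_mul (3 * (2 * zeta3 + 1)))
      have lB1 := (l2.sub tendsto_phi3).add
        (tendsto_psi3.const_mul (3 * (2 * zeta3 + 1) * zeta3))
      have lB2 := (tendsto_phi3.sub l1).add
        (tendsto_psi3.const_mul (3 * (2 * zeta3 + 1) * zeta3 ^ 2))
      simpa using (lA.mul (lB0.mul (lB1.mul lB2))).mul (tendsto_eta.pow 8)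
  -- `B0`, `B1`, `B2` are translates of each other, and `A` is `B0` at `-1/z` up to a factor
  have a : (∀ z : ℂ, 0 < z.im → B0 z = 0) → ∀ z : ℂ, 0 < z.im → A z = 0 := by
    intro H z hz
    have h1 := sB0 z hz
    rw [H _ (neg_one_div_im_pos hz)] at h1
    simpa [ne_zero_of_im_pos hz] using h1.symm
  rcases mul_eq_zero_on_upperHalfPlane hA (hB0.mul (hB1.mul hB2)) key with H | H
  · exact H z hz
  · refine a ?_ z hz
    rcases mul_eq_zero_on_upperHalfPlane hB0 (hB1.mul hB2) H with H | H
    · exact H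
    · rcases mul_eq_zero_on_upperHalfPlane hB1 hB2 H with H | H
      · exact fun z hz ↦ by rw [← tB2, ← tB1, H _ (im_add_one_pos (im_add_one_pos hz))]
      · exact fun z hz ↦ by rw [← tB2, H _ (im_add_one_pos hz)]

/-- The trisection at `z` and at `-1/z` are two linear relations between `φ(z)`, `φ(z + 1)`,
`φ(z + 2)` and `ψ(z)`. -/
theorem phi3_add_one {z : ℂ} (hz : 0 < z.im) :
    phi3 (z + 1) = phi3 z + 3 * (1 - zeta3) * psi3 z := by
  have h0 := ne_zero_of_im_pos hz
  have hw := zeta3_sq_add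
  have h1 := phi3_trisection hz
  have h2 := phi3_trisection (neg_one_div_im_pos hz)
  rw [phi3_neg_inv hz, phi3_neg_inv_add_one hz, phi3_neg_inv_add_two hz] at h2
  have h3 : 3 * (2 * zeta3 + 1) * psi3 z + phi3 (z + 1) - phi3 (z + 1 + 1) = 0 := by
    apply mul_left_cancel₀ h0
    grind
  grind

theorem eta_pow_eight_eq {z : ℂ} (hz : 0 < z.im) :
    η z ^ 8 = phi3 z * psi3 z * (phi3 z ^ 2 + 9 * phi3 z * psi3 z + 27 * psi3 z ^ 2) := by
  have hw := zeta3_sq_add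
  have key : phi3 z * (phi3 z ^ 2 + 9 * phi3 z * psi3 z + 27 * psi3 z ^ 2) *
      (psi3 z / η z ^ 8) - 1 = 0 := by
    refine eq_zero_of_levelOne (k := 0) (by norm_num)
      (f := fun z ↦ phi3 z * (phi3 z ^ 2 + 9 * phi3 z * psi3 z + 27 * psi3 z ^ 2) *
        (psi3 z / η z ^ 8) - 1) ?_ ?_ ?_ ?_ hz
    · exact ((differentiableOn_phi3.mul (((differentiableOn_phi3.pow 2).add
        ((differentiableOn_phi3.const_mul 9).mul differentiableOn_psi3)).add
        ((differentiableOn_psi3.pow 2).const_mul 27))).mul (differentiableOn_psi3.div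
          (fun z hz ↦ ((differentiableAt_eta hz).pow 8).differentiableWithinAt)
          fun z hz ↦ pow_ne_zero _ (eta_ne_zero hz))).sub_const 1
    · intro z hz
      have hw0 : zeta3 ≠ 0 := Complex.exp_ne_zero _
      simp only [phi3_add_one hz, psi3_add_one, eta_pow_eight_add_one]
      rw [mul_div_mul_left _ _ hw0]
      have : (phi3 z + 3 * (1 - zeta3) * psi3 z) * ((phi3 z + 3 * (1 - zeta3) * psi3 z) ^ 2 +
          9 * (phi3 z + 3 * (1 - zeta3) * psi3 z) * (zeta3 * psi3 z) +
          27 * (zeta3 * psi3 z) ^ 2) =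
          phi3 z * (phi3 z ^ 2 + 9 * phi3 z * psi3 z + 27 * psi3 z ^ 2) := by grind
      rw [this]
    · intro z hz
      have h := ne_zero_of_im_pos hz
      have h' := eta_ne_zero_of_im_pos hz
      simp only [phi3_neg_inv hz, psi3_neg_inv hz, eta_pow_eight_neg_inv hz]
      have hs2 : (2 * zeta3 + 1) ^ 2 = -3 := by linear_combination 4 * hw
      have hs4 : (2 * zeta3 + 1) ^ 4 = 9 := by
        linear_combination ((2 * zeta3 + 1) ^ 2 - 3) * hs2
      generalize 2 * zeta3 + 1 = s at hs2 hs4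
      field_simp
      grind
    · have h1 := ((tendsto_phi3.mul (((tendsto_phi3.pow 2).add
        ((tendsto_phi3.const_mul 9).mul tendsto_psi3)).add
        ((tendsto_psi3.pow 2).const_mul 27))).mul tendsto_psi3_div_eta).sub_const 1
      simpa using h1
  have h' := eta_ne_zero_of_im_pos hz
  field_simp at key
  linear_combination -key

/-- The cubic theta function `a(z)`, a form of weight one for `Γ₀(3)` with character. -/
noncomputable def U3 (z : ℂ) : ℂ := phi3 z + 3 * psi3 z

theorem U3_add_one {z : ℂ} (hz : 0 < z.im) : U3 (z + 1) = U3 z := by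
  rw [U3, U3, phi3_add_one hz, psi3_add_one]
  ring

theorem U3_neg_inv {z : ℂ} (hz : 0 < z.im) :
    U3 (-1 / z) = -(2 * zeta3 + 1) * z / 3 * (U3 z + 6 * psi3 z) := by
  rw [U3, U3, phi3_neg_inv hz, psi3_neg_inv hz]
  ring

theorem differentiableOn_U3 : DifferentiableOn ℂ U3 upperHalfPlaneSet :=
  differentiableOn_phi3.add (differentiableOn_psi3.const_mul 3)

theorem tendsto_U3 : Tendsto U3 (comap Complex.im atTop) (𝓝 1) := by
  have h := tendsto_phi3.add (tendsto_psi3.const_mul 3)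
  rw [mul_zero, add_zero] at h
  exact h

/-- With `u = (z - 1) / 3` the argument on the left is `u / (3u + 1)`, the image of `u` under an
element of `Γ₀(3)`, which is decomposed as `u ↦ -1/u ↦ -1/u - 3 ↦ -1/(-1/u - 3)`. -/
theorem U3_neg_inv_add_one_third {z : ℂ} (hz : 0 < z.im) :
    U3 ((-1 / z + 1) / 3) = z * U3 ((z + 1 + 1) / 3) := by
  have h := ne_zero_of_im_pos hz
  have hu : 0 < ((z - 1) / 3).im := im_third_pos (by simpa using hz)
  set u := (z - 1) / 3 with hu'
  have hz' : z = 3 * u + 1 := by rw [hu']; ring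
  have h0 := ne_zero_of_im_pos hu
  have hv0 := neg_one_div_im_pos hu
  have hv : 0 < (-1 / u - 3).im := by simpa using hv0
  have hv' := ne_zero_of_im_pos hv
  have hv2 : -1 / u - 3 = -z / u := by
    rw [hz']
    field_simp
    ring
  have e1 : -1 / (-1 / u - 3) = (-1 / z + 1) / 3 := by
    rw [hv2, hu']
    have : z - 1 ≠ 0 := by
      intro h'
      rw [hu', h', zero_div] at h0
      exact h0 rfl
    field_simp
    ring
  have e2 := U3_neg_inv hv
  have e3 := phi3_add_three (-1 / u - 3)
  have e4 : psi3 (-1 / u - 3 + 1 + 1 + 1) = psi3 (-1 / u - 3) := by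
    rw [psi3_add_one, psi3_add_one, psi3_add_one]
    linear_combination (zeta3 - 1) * psi3 (-1 / u - 3) * zeta3_sq_add
  rw [show -1 / u - 3 + 1 + 1 + 1 = -1 / u by ring] at e3 e4
  have e5 := U3_add_one hu
  rw [show u + 1 = (z + 1 + 1) / 3 by rw [hu']; ring] at e5
  rw [← e1, e2, e5, U3, ← e3, ← e4, phi3_neg_inv hu, psi3_neg_inv hu, U3, hv2]
  field_simp
  linear_combination -(36 * phi3 u + 108 * psi3 u) * zeta3_sq_add

/-- The identity `a(z) = b(z) + 3 c(3z)`. The difference `D` of the two sides is a form for `Γ₀(3)`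
with character; its transforms `D0`, `D1`, `D2` belong to the other cosets, and `D D0 D1 D2` is of
level one and weight four. -/
theorem U3_eq {z : ℂ} (hz : 0 < z.im) : U3 z = phi3 (3 * z) + 9 * psi3 (3 * z) := by
  have hw := zeta3_sq_add
  let D : ℂ → ℂ := fun z ↦ phi3 (3 * z) + 9 * psi3 (3 * z) - U3 z
  let D0 : ℂ → ℂ := fun z ↦ U3 (z / 3) - U3 z - 6 * psi3 z
  let D1 : ℂ → ℂ := fun z ↦ U3 ((z + 1) / 3) - U3 z - 6 * zeta3 * psi3 z
  let D2 : ℂ → ℂ := fun z ↦ U3 ((z + 1 + 1) / 3) - U3 z - 6 * zeta3 ^ 2 * psi3 z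
  have hD : DifferentiableOn ℂ D upperHalfPlaneSet :=
    ((differentiableOn_phi3.comp (by fun_prop) fun z hz ↦ im_three_mul_pos hz).add
      ((differentiableOn_psi3.comp (by fun_prop) fun z hz ↦ im_three_mul_pos hz).const_mul 9)).sub
      differentiableOn_U3
  have hD0 : DifferentiableOn ℂ D0 upperHalfPlaneSet :=
    ((differentiableOn_U3.comp (by fun_prop) fun z hz ↦ im_third_pos hz).sub
      differentiableOn_U3).sub (differentiableOn_psi3.const_mul 6)
  have hD1 : DifferentiableOn ℂ D1 upperHalfPlaneSet :=
    ((differentiableOn_U3.comp (by fun_prop) fun z hz ↦ im_third_pos (im_add_one_pos hz)).sub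
      differentiableOn_U3).sub (differentiableOn_psi3.const_mul _)
  have hD2 : DifferentiableOn ℂ D2 upperHalfPlaneSet :=
    ((differentiableOn_U3.comp (by fun_prop)
      fun z hz ↦ im_third_pos (im_add_one_pos (im_add_one_pos hz))).sub
      differentiableOn_U3).sub (differentiableOn_psi3.const_mul _)
  have sD : ∀ z : ℂ, 0 < z.im → D (-1 / z) = -(2 * zeta3 + 1) * z / 3 * D0 z := by
    intro z hz
    have h := ne_zero_of_im_pos hz
    simp only [D, D0]
    rw [show 3 * (-1 / z) = -1 / (z / 3) by field_simp, phi3_neg_inv (im_third_pos hz),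
      psi3_neg_inv (im_third_pos hz), U3_neg_inv hz]
    simp only [U3]
    ring
  have sD0 : ∀ z : ℂ, 0 < z.im → D0 (-1 / z) = -(2 * zeta3 + 1) * z * D z := by
    intro z hz
    have h := ne_zero_of_im_pos hz
    have h1 := sD _ (neg_one_div_im_pos hz)
    rw [show -1 / (-1 / z) = z by field_simp] at h1
    rw [h1]
    generalize D0 (-1 / z) = y
    field_simp
    linear_combination 4 * y * hw
  have sD1 : ∀ z : ℂ, 0 < z.im → D1 (-1 / z) = z * D2 z := by
    intro z hz
    simp only [D1, D2]
    rw [U3_neg_inv_add_one_third hz, U3_neg_inv hz, psi3_neg_inv hz]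
    simp only [U3]
    grind
  have sD2 : ∀ z : ℂ, 0 < z.im → D2 (-1 / z) = -z * D1 z := by
    intro z hz
    have h := ne_zero_of_im_pos hz
    have h1 := sD1 _ (neg_one_div_im_pos hz)
    rw [show -1 / (-1 / z) = z by field_simp] at h1
    rw [h1]
    field_simp
  have tD0 : ∀ z : ℂ, 0 < z.im → D0 (z + 1) = D1 z := by
    intro z hz
    simp only [D0, D1]
    rw [U3_add_one hz, psi3_add_one]
    ring
  have tD1 : ∀ z : ℂ, 0 < z.im → D1 (z + 1) = D2 z := by
    intro z hz
    simp only [D1, D2]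
    rw [U3_add_one hz, psi3_add_one]
    ring
  have tD2 : ∀ z : ℂ, 0 < z.im → D2 (z + 1) = D0 z := by
    intro z hz
    simp only [D0, D2]
    rw [U3_add_one hz, psi3_add_one, show (z + 1 + 1 + 1) / 3 = z / 3 + 1 by ring,
      U3_add_one (im_third_pos hz)]
    linear_combination -6 * psi3 z * (zeta3 - 1) * hw
  have tD : ∀ z : ℂ, 0 < z.im → D (z + 1) = D z := by
    intro z hz
    simp only [D]
    rw [U3_add_one hz, mul_add, mul_one, show 3 * z + 3 = 3 * z + 1 + 1 + 1 by ring,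
      phi3_add_three, psi3_add_one, psi3_add_one, psi3_add_one]
    linear_combination 9 * psi3 (3 * z) * (zeta3 - 1) * hw
  have key : ∀ z : ℂ, 0 < z.im → D z * (D0 z * (D1 z * D2 z)) = 0 := by
    intro z hz
    refine eq_zero_of_levelOne (k := 4) (by norm_num) (f := fun z ↦ D z * (D0 z * (D1 z * D2 z)))
      (hD.mul (hD0.mul (hD1.mul hD2))) ?_ ?_ ?_ hz
    · intro z hz
      simp only [tD z hz, tD0 z hz, tD1 z hz, tD2 z hz]
      ring
    · intro z hz
      simp only [sD z hz, sD0 z hz, sD1 z hz, sD2 z hz]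
      linear_combination -4 / 3 * z ^ 4 * (D z * (D0 z * (D1 z * D2 z))) * hw
    · have l0 := ((tendsto_phi3.comp (tendsto_mul_comap_im three_pos)).add
        ((tendsto_psi3.comp (tendsto_mul_comap_im three_pos)).const_mul 9)).sub tendsto_U3
      have l1 := ((tendsto_U3.comp (tendsto_div_comap_im three_pos)).sub tendsto_U3).sub
        (tendsto_psi3.const_mul 6)
      have l2 := ((tendsto_U3.comp ((tendsto_div_comap_im three_pos).comp
        (tendsto_add_comap_im 1))).sub tendsto_U3).sub (tendsto_psi3.const_mul (6 * zeta3))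
      have l3 := ((tendsto_U3.comp ((tendsto_div_comap_im three_pos).comp
        ((tendsto_add_comap_im 1).comp (tendsto_add_comap_im 1)))).sub tendsto_U3).sub
        (tendsto_psi3.const_mul (6 * zeta3 ^ 2))
      simpa [Function.comp_def] using l0.mul (l1.mul (l2.mul l3))
  have d0 : (∀ z : ℂ, 0 < z.im → D0 z = 0) → ∀ z : ℂ, 0 < z.im → D z = 0 := by
    intro H z hz
    have h := ne_zero_of_im_pos hz
    have h2 := sD _ (neg_one_div_im_pos hz)
    rw [H _ (neg_one_div_im_pos hz), mul_zero, show -1 / (-1 / z) = z by field_simp] at h2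
    exact h2
  have d : ∀ z : ℂ, 0 < z.im → D z = 0 := by
    rcases mul_eq_zero_on_upperHalfPlane hD (hD0.mul (hD1.mul hD2)) key with H | H
    · exact H
    · refine d0 ?_
      rcases mul_eq_zero_on_upperHalfPlane hD0 (hD1.mul hD2) H with H | H
      · exact H
      · rcases mul_eq_zero_on_upperHalfPlane hD1 hD2 H with H | H
        · exact fun z hz ↦ by
            rw [← tD2 z hz, ← tD1 _ (im_add_one_pos hz), H _ (im_add_one_pos (im_add_one_pos hz))]
        · exact fun z hz ↦ by rw [← tD2 z hz, H _ (im_add_one_pos hz)]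
  linear_combination -d z hz

theorem eisC_four_eq_level_three {z : ℂ} (hz : 0 < z.im) : eisC (by norm_num : 3 ≤ 4) z =
    U3 z * (U3 z ^ 3 + 216 * psi3 z ^ 3) := by
  have hw := zeta3_sq_add
  rw [← sub_eq_zero]
  refine eq_zero_of_levelOne (k := 4) (by norm_num)
    (f := fun z ↦ eisC (by norm_num : 3 ≤ 4) z -
      U3 z * (U3 z ^ 3 + 216 * psi3 z ^ 3)) ?_ ?_ ?_ ?_ hz
  · exact (eisC_differentiableOn _).sub (differentiableOn_U3.mul
      ((differentiableOn_U3.pow 3).add ((differentiableOn_psi3.pow 3).const_mul 216)))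
  · intro z hz
    simp only [eisC_add_one, U3_add_one hz, psi3_add_one]
    linear_combination -216 * U3 z * psi3 z ^ 3 * (zeta3 - 1) * hw
  · intro z hz
    simp only [eisC_neg_inv _ hz, U3_neg_inv hz, psi3_neg_inv hz]
    have hs2 : (2 * zeta3 + 1) ^ 2 = -3 := by linear_combination 4 * hw
    have hs4 : (2 * zeta3 + 1) ^ 4 = 9 := by
      linear_combination ((2 * zeta3 + 1) ^ 2 - 3) * hs2
    have hX : phi3 z = U3 z - 3 * psi3 z := by rw [U3]; ring
    rw [hX]
    linear_combination -(z ^ 4 / 9) * U3 z * (U3 z ^ 3 + 216 * psi3 z ^ 3) * hs4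
  · simpa using (tendsto_eisC (by norm_num : 3 ≤ 4) ⟨2, rfl⟩).sub (tendsto_U3.mul
      ((tendsto_U3.pow 3).add ((tendsto_psi3.pow 3).const_mul 216)))

theorem eisC_eight_sub_level_three {z : ℂ} (hz : 0 < z.im) :
    eisC (by norm_num : 3 ≤ 8) z - eisC (by norm_num : 3 ≤ 8) (3 * z) =
      480 * (η z ^ 12 * η (3 * z) ^ 4 + 18 * (η z ^ 9 * η (3 * z) ^ 4 * η (9 * z) ^ 3)
        + 81 * (η z ^ 6 * η (3 * z) ^ 4 * η (9 * z) ^ 6) + 123 *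
      ((eisC (by norm_num : 3 ≤ 4) z - eisC (by norm_num : 3 ≤ 4) (3 * z)) / 240) ^ 2) := by
  have hz3 := im_three_mul_pos hz
  have n1 := eta_ne_zero_of_im_pos hz
  have n3 := eta_ne_zero_of_im_pos hz3
  have h8 := eta_pow_eight_eq hz3
  have hU := U3_eq hz
  have hU' : U3 (3 * z) = phi3 (3 * z) + 3 * psi3 (3 * z) := rfl
  set b := phi3 (3 * z) with hb
  set d := psi3 (3 * z) with hd
  have hb' : b * η (3 * z) = η z ^ 3 := by
    rw [hb, phi3, mul_div_cancel_left₀ z three_ne_zero]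
    field_simp
  have hd' : d * η (3 * z) = η (9 * z) ^ 3 := by
    rw [hd, psi3, show 3 * (3 * z) = 9 * z by ring, div_mul_cancel₀ _ n3]
  have hY : psi3 z ^ 3 = d * (b ^ 2 + 9 * b * d + 27 * d ^ 2) := by
    have hb0 : b ≠ 0 := by
      intro h
      rw [h, zero_mul] at hb'
      exact pow_ne_zero _ n1 hb'.symm
    have : psi3 z ^ 3 * b = η (3 * z) ^ 8 := by
      have : psi3 z ^ 3 * η z ^ 3 = η (3 * z) ^ 9 := by
        rw [psi3]
        field_simp
      rw [← hb'] at this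
      apply mul_right_cancel₀ n3
      linear_combination this
    apply mul_right_cancel₀ hb0
    rw [this, h8]
    ring
  have hΔ : η z ^ 12 * η (3 * z) ^ 4 + 18 * (η z ^ 9 * η (3 * z) ^ 4 * η (9 * z) ^ 3)
        + 81 * (η z ^ 6 * η (3 * z) ^ 4 * η (9 * z) ^ 6) =
      b ^ 2 * (b + 9 * d) ^ 2 * (b * d * (b ^ 2 + 9 * b * d + 27 * d ^ 2)) := by
    rw [← h8, show η z ^ 12 = (η z ^ 3) ^ 4 by ring, show η z ^ 9 = (η z ^ 3) ^ 3 by ring,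
      show η z ^ 6 = (η z ^ 3) ^ 2 by ring, show η (9 * z) ^ 6 = (η (9 * z) ^ 3) ^ 2 by ring,
      ← hb', ← hd']
    ring
  rw [eisC_eight hz, eisC_eight hz3, hΔ, eisC_four_eq_level_three hz, eisC_four_eq_level_three hz3,
    hY, hU, hU']
  ring

/-! ### Fourier coefficients -/

/-- The integer `σ_k(n) - σ_k(n / m)`, where the second term is absent if `m ∤ n`. -/
def sigmaDiff (k m n : ℕ) : ℤ :=
  ArithmeticFunction.sigma k n - if m ∣ n then (ArithmeticFunction.sigma k (n / m) : ℤ) else 0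

/-- The `n`-th coefficient of `∑ (σ₇(n) - σ₇(n / m)) q^n - K (∑ (σ₃(n) - σ₃(n / m)) q^n)^2`. -/
def tauCoeff (m K n : ℕ) : ℤ :=
  sigmaDiff 7 m n -
    K * ∑ x ∈ Finset.HasAntidiagonal.antidiagonal n, sigmaDiff 3 m x.1 * sigmaDiff 3 m x.2

theorem hasSum_eisC_sub {k : ℕ} (hk : 3 ≤ k) (hk2 : Even k) {C : ℂ} (hC : C ≠ 0)
    (hB : -(2 * k / bernoulli k : ℂ) = C) {m : ℕ} (hm : 0 < m) {z : ℂ} (hz : 0 < z.im) :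
    HasSum (fun n : ℕ ↦ (sigmaDiff (k - 1) m n : ℂ) *
      Complex.exp (2 * Real.pi * Complex.I * z) ^ n)
      ((eisC hk z - eisC hk (m * z)) / C) := by
  have h1 := eisC_hasSum hk hk2 hz
  have h2 := eisC_hasSum hk hk2 (im_mul_pos hz hm)
  set q := Complex.exp (2 * Real.pi * Complex.I * z) with hq
  have hqm : Complex.exp (2 * Real.pi * Complex.I * (m * z)) = q ^ m := by
    rw [hq, ← Complex.exp_nat_mul]
    ring_nf
  rw [hqm] at h2
  -- the expansion of `E_k(mz)` in powers of `q` rather than of `q ^ m`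
  have h3 : HasSum (fun n : ℕ ↦ if m ∣ n then (if n = 0 then 1 else -(2 * k / bernoulli k : ℂ) *
      (ArithmeticFunction.sigma (k - 1) (n / m))) * q ^ n else 0) (eisC hk (m * z)) := by
    refine ((mul_right_injective₀ hm.ne').hasSum_iff fun n hn ↦ if_neg ?_).mp ?_
    · rintro ⟨c, rfl⟩
      exact hn ⟨c, rfl⟩
    · convert! h2 using 2 with n
      simp [hm.ne', Nat.mul_div_cancel_left n hm, pow_mul]
  refine ((h1.sub h3).div_const C).congr_fun ?_
  intro n
  rw [hB, sigmaDiff]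
  rcases Nat.eq_zero_or_pos n with rfl | hn
  · simp
  · by_cases hmn : m ∣ n
    · simp only [hn.ne', hmn, if_true, if_false]
      push_cast
      field_simp
    · simp only [hn.ne', hmn, if_false, sub_zero]
      push_cast
      field_simp

theorem hasSum_tauCoeff {m : ℕ} (hm : 0 < m) (K : ℕ) {z : ℂ} (hz : 0 < z.im) {G : ℂ}
    (h : eisC (by norm_num : 3 ≤ 8) z - eisC (by norm_num : 3 ≤ 8) (m * z) =
      480 * (G + K *
      ((eisC (by norm_num : 3 ≤ 4) z - eisC (by norm_num : 3 ≤ 4) (m * z)) / 240) ^ 2)) :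
    HasSum (fun n : ℕ ↦ (tauCoeff m K n : ℂ) * Complex.exp (2 * Real.pi * Complex.I * z) ^ n)
      G := by
  have h4 := hasSum_eisC_sub (k := 4) (by norm_num) ⟨2, rfl⟩ (C := 240) (by norm_num)
    (by norm_num [show bernoulli 4 = -1 / 30 by decide +kernel]) hm hz
  have h8 := hasSum_eisC_sub (k := 8) (by norm_num) ⟨4, rfl⟩ (C := 480) (by norm_num)
    (by norm_num [show bernoulli 8 = -1 / 30 by decide +kernel]) hm hz
  set q := Complex.exp (2 * Real.pi * Complex.I * z) with hq
  have hsq : HasSum (fun n ↦ ∑ x ∈ Finset.HasAntidiagonal.antidiagonal n,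
      ((sigmaDiff 3 m x.1 : ℂ) * q ^ x.1) * ((sigmaDiff 3 m x.2 : ℂ) * q ^ x.2))
      (((eisC (by norm_num : 3 ≤ 4) z - eisC (by norm_num : 3 ≤ 4) (m * z)) / 240) ^ 2) := by
    have hn := h4.summable.norm
    rw [sq, ← h4.tsum_eq, tsum_mul_tsum_eq_tsum_sum_antidiagonal_of_summable_norm hn hn]
    exact (summable_norm_sum_mul_antidiagonal_of_summable_norm hn hn).of_norm.hasSum
  have hG : G = (eisC (by norm_num : 3 ≤ 8) z - eisC (by norm_num : 3 ≤ 8) (m * z)) / 480 -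
      K * ((eisC (by norm_num : 3 ≤ 4) z - eisC (by norm_num : 3 ≤ 4) (m * z)) / 240) ^ 2 := by
    rw [h]
    ring
  rw [hG]
  refine (h8.sub (hsq.mul_left (K : ℂ))).congr_fun fun n ↦ ?_
  have : ∑ x ∈ Finset.HasAntidiagonal.antidiagonal n,
      ((sigmaDiff 3 m x.1 : ℂ) * q ^ x.1) * ((sigmaDiff 3 m x.2 : ℂ) * q ^ x.2) =
      (∑ x ∈ Finset.HasAntidiagonal.antidiagonal n,
        (sigmaDiff 3 m x.1 : ℂ) * (sigmaDiff 3 m x.2 : ℂ)) * q ^ n := by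
    rw [Finset.sum_mul]
    refine Finset.sum_congr rfl fun x hx ↦ ?_
    rw [← Finset.HasAntidiagonal.mem_antidiagonal.mp hx, pow_add]
    ring
  rw [this, tauCoeff]
  push_cast
  ring

/-- The periodicity and the boundedness at `i∞` needed to identify the coefficients with those of
`qExpansion` both follow from the convergence of the series. -/
theorem qExpansion_coeff_of_hasSum {f : ℍ → ℂ} {c : ℕ → ℂ}
    (hf : DifferentiableOn ℂ (f ∘ ofComplex) upperHalfPlaneSet)
    (h : ∀ z : ℍ, HasSum (fun n ↦ c n * Complex.exp (2 * Real.pi * Complex.I * (z : ℂ)) ^ n) (f z))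
    (n : ℕ) : (qExpansion 1 f).coeff n = c n := by
  have h' : ∀ τ : ℍ, HasSum (fun n ↦ c n • Function.Periodic.qParam 1 τ ^ n) (f τ) := by
    simpa [Function.Periodic.qParam] using h
  have hper : Function.Periodic (f ∘ ofComplex) (1 : ℝ) := by
    intro w
    by_cases! hw : 0 < w.im
    · have hw' : 0 < (w + (1 : ℝ)).im := by simpa using hw
      simp only [Function.comp_apply, ofComplex_apply_of_im_pos hw, ofComplex_apply_of_im_pos hw']
      have h1 := h ⟨w + (1 : ℝ), hw'⟩
      have e : Complex.exp (2 * Real.pi * Complex.I * (w + (1 : ℝ))) =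
          Complex.exp (2 * Real.pi * Complex.I * w) := by
        rw [Complex.ofReal_one, mul_add, Complex.exp_add, mul_one, Complex.exp_two_pi_mul_I,
          mul_one]
      simp only [e] at h1
      exact h1.unique (h ⟨w, hw⟩)
    -- below the real axis `ofComplex` is constant
    · have hw' : (w + (1 : ℝ)).im ≤ 0 := by simpa using hw
      simp only [Function.comp_apply, ofComplex_apply_of_im_nonpos hw,
        ofComplex_apply_of_im_nonpos hw']
  -- the uniqueness statement is about elements of a `FunLike` type
  let _ : FunLike (ℍ → ℂ) ℍ ℂ := ⟨id, Function.injective_id⟩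
  exact (qExpansion_coeff_unique f one_pos (analyticAt_cuspFunction_zero one_pos hper
    (UpperHalfPlane.mdifferentiable_iff.mpr hf)
    (isBoundedAtImInfty_of_hasSum_qExpansion one_pos h')) h' n).symm

theorem differentiableOn_Delta82 : DifferentiableOn ℂ (Delta82 ∘ ofComplex) upperHalfPlaneSet := by
  have : DifferentiableOn ℂ (fun z : ℂ ↦ η z ^ 8 * η (2 * z) ^ 8) upperHalfPlaneSet :=
    fun z hz ↦ (((differentiableAt_eta hz).pow 8).mul
      ((differentiableAt_eta_mul 2 two_pos hz).pow 8)).differentiableWithinAt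
  exact this.congr fun z hz ↦ by simp [Delta82, ofComplex_apply_of_im_pos hz]

theorem differentiableOn_Delta83 : DifferentiableOn ℂ (Delta83 ∘ ofComplex) upperHalfPlaneSet := by
  have : DifferentiableOn ℂ (fun z : ℂ ↦ η z ^ 12 * η (3 * z) ^ 4
      + 18 * (η z ^ 9 * η (3 * z) ^ 4 * η (9 * z) ^ 3)
      + 81 * (η z ^ 6 * η (3 * z) ^ 4 * η (9 * z) ^ 6)) upperHalfPlaneSet := by
    intro z hz
    have h1 := differentiableAt_eta hz
    have h3 := differentiableAt_eta_mul 3 three_pos hz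
    have h9 := differentiableAt_eta_mul 9 (by norm_num) hz
    push_cast at h3 h9
    exact ((((h1.pow 12).mul (h3.pow 4)).add
      ((((h1.pow 9).mul (h3.pow 4)).mul (h9.pow 3)).const_mul 18)).add
      ((((h1.pow 6).mul (h3.pow 4)).mul (h9.pow 6)).const_mul 81)).differentiableWithinAt
  exact this.congr fun z hz ↦ by simp [Delta83, ofComplex_apply_of_im_pos hz]

theorem hasSum_Delta82 (z : ℍ) : HasSum (fun n : ℕ ↦ (tauCoeff 2 136 n : ℂ) *
    Complex.exp (2 * Real.pi * Complex.I * (z : ℂ)) ^ n) (Delta82 z) :=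
  hasSum_tauCoeff two_pos 136 z.im_pos (by exact_mod_cast eisC_eight_sub_level_two z.im_pos)

theorem hasSum_Delta83 (z : ℍ) : HasSum (fun n : ℕ ↦ (tauCoeff 3 123 n : ℂ) *
    Complex.exp (2 * Real.pi * Complex.I * (z : ℂ)) ^ n) (Delta83 z) :=
  hasSum_tauCoeff three_pos 123 z.im_pos (by exact_mod_cast eisC_eight_sub_level_three z.im_pos)

theorem tauCoeff_zero (m K : ℕ) : tauCoeff m K 0 = 0 := by
  simp [tauCoeff, sigmaDiff]

/-- If `m ∤ n` and `ℓ ∣ K`, both the term `σ₇(n / m)` and the square disappear modulo `ℓ`. -/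
theorem tauCoeff_modEq {m K ℓ n : ℕ} (hK : ℓ ∣ K) (hn : ¬ m ∣ n) :
    tauCoeff m K n ≡ ArithmeticFunction.sigma 7 n [ZMOD ℓ] := by
  obtain ⟨c, rfl⟩ := hK
  rw [tauCoeff, sigmaDiff, if_neg hn, sub_zero]
  refine Int.modEq_iff_dvd.mpr ?_
  rw [sub_sub_cancel]
  rw [Nat.cast_mul, mul_assoc]
  exact dvd_mul_right _ _

theorem not_dvd_prime_pow {p r : ℕ} (hp : p.Prime) (hr : r.Prime) (h : r ≠ p) (l : ℕ) :
    ¬ r ∣ p ^ l :=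
  fun hd ↦ h ((Nat.prime_dvd_prime_iff_eq hr hp).mp (hr.dvd_of_dvd_pow hd))

theorem sigma_prime_pow_modEq_one {p k : ℕ} (hp : p.Prime) (hk : k ≠ 0) (l : ℕ) :
    (ArithmeticFunction.sigma k (p ^ l) : ℤ) ≡ 1 [ZMOD p] := by
  rw [ArithmeticFunction.sigma_apply_prime_pow hp, Finset.sum_range_succ']
  refine (Int.modEq_iff_dvd.mpr ?_).symm
  push_cast
  rw [zero_mul, pow_zero, add_sub_cancel_right]
  exact Finset.dvd_sum fun j _ ↦ dvd_pow_self _ (mul_ne_zero (Nat.succ_ne_zero j) hk)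

theorem hasSum_succ_of_zero {c : ℕ → ℂ} {q a : ℂ} (h0 : c 0 = 0)
    (h : HasSum (fun n ↦ c n * q ^ n) a) : HasSum (fun n ↦ c (n + 1) * q ^ (n + 1)) a := by
  rw [← hasSum_nat_add_iff' 1] at h
  simpa [h0] using h

end

/-- The Fourier coefficients of `Δ_{8,2}` and `Δ_{8,3}` are rational integers `t₂ n`, `t₃ n`, the
Fourier expansions (over `n ≥ 1`) converge to the two functions on the whole upper half-plane, and
the coefficients satisfy the stated congruences. -/
theorem corollary4p7 :
    ∃ t₂ t₃ : ℕ → ℤ,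
      (∀ n : ℕ, tau82 n = (t₂ n : ℂ)) ∧
      (∀ n : ℕ, tau83 n = (t₃ n : ℂ)) ∧
      (∀ z : ℍ, HasSum
        (fun n : ℕ ↦ tau82 (n + 1) * Complex.exp (2 * Real.pi * Complex.I * (z : ℂ)) ^ (n + 1))
        (Delta82 z)) ∧
      (∀ z : ℍ, HasSum
        (fun n : ℕ ↦ tau83 (n + 1) * Complex.exp (2 * Real.pi * Complex.I * (z : ℂ)) ^ (n + 1))
        (Delta83 z)) ∧
      (∀ l : ℕ, 1 ≤ l →
        (∀ p : ℕ, p.Prime → Odd p →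
          t₂ (p ^ l) ≡ (ArithmeticFunction.sigma 7 (p ^ l) : ℤ) [ZMOD 17]) ∧
        (∀ p : ℕ, p.Prime → 5 ≤ p →
          t₃ (p ^ l) ≡ (ArithmeticFunction.sigma 7 (p ^ l) : ℤ) [ZMOD 41]) ∧
        t₂ (17 ^ l) ≡ 1 [ZMOD 17] ∧
        t₃ (41 ^ l) ≡ 1 [ZMOD 41]) := by

  have h2 := qExpansion_coeff_of_hasSum differentiableOn_Delta82 hasSum_Delta82
  have h3 := qExpansion_coeff_of_hasSum differentiableOn_Delta83 hasSum_Delta83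
  have c2 : ∀ n : ℕ, ¬ 2 ∣ n → tauCoeff 2 136 n ≡ ArithmeticFunction.sigma 7 n [ZMOD 17] :=
    fun n hn ↦ tauCoeff_modEq (ℓ := 17) (by norm_num) hn
  have c3 : ∀ n : ℕ, ¬ 3 ∣ n → tauCoeff 3 123 n ≡ ArithmeticFunction.sigma 7 n [ZMOD 41] :=
    fun n hn ↦ tauCoeff_modEq (ℓ := 41) (by norm_num) hn
  refine ⟨tauCoeff 2 136, tauCoeff 3 123, h2, h3, fun z ↦ ?_, fun z ↦ ?_, fun l _ ↦
    ⟨fun p hp hodd ↦ ?_, fun p hp h5 ↦ ?_, ?_, ?_⟩⟩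
  · refine hasSum_succ_of_zero (by rw [tau82, h2, tauCoeff_zero, Int.cast_zero]) ?_
    simpa only [tau82, h2] using hasSum_Delta82 z
  · refine hasSum_succ_of_zero (by rw [tau83, h3, tauCoeff_zero, Int.cast_zero]) ?_
    simpa only [tau83, h3] using hasSum_Delta83 z
  · refine c2 _ (not_dvd_prime_pow hp Nat.prime_two ?_ l)
    rintro rfl
    exact absurd hodd (by decide)
  · exact c3 _ (not_dvd_prime_pow hp Nat.prime_three (by omega) l)
  · exact (c2 _ (not_dvd_prime_pow (by norm_num) Nat.prime_two (by norm_num) l)).trans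
      (sigma_prime_pow_modEq_one (p := 17) (by norm_num) (by norm_num) l)
  · exact (c3 _ (not_dvd_prime_pow (by norm_num) Nat.prime_three (by norm_num) l)).trans
      (sigma_prime_pow_modEq_one (p := 41) (by norm_num) (by norm_num) l)
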